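/- **Setting.** Let $p_1,p_2,p_3\in\mathbb R^2$ be the vertices of a regular triangle with $p_1+p_2+p_3=0$ and $|p_i-p_j|=1$ for $i\ne j$, and let $\alpha\in(0,1)$. Put $G_i(x)=\frac{1-\alpha}{2}(x-p_i)+p_i$, $p_{ij}=G_i(p_j)$, $B=\{(1,2),(2,3),(3,1)\}$, and let $e_{ij}$ be the line segment from $p_{ij}$ to $p_{ji}$. For a word $w=w_1\cdots w_m\in W_m=\{1,2,3\}^m$ let $G_w=G_{w_1}\circ\cdots\circ G_{w_m}$ ($G_\emptyset=\mathrm{id}$) and $e_{ij}^w=G_w(e_{ij})$; put $W_*=\bigcup_{m\ge0}W_m$. The stretched Sierpinski gasket $K$ is the unique compact set with $K=\bigcup_{i=1}^3G_i(K)\cup\bigcup_{(i,j)\in B}e_{ij}$. Put $V_0=\{p_1,p_2,p_3\}$. Let $\widetilde{\mathcal F}$ be the set of all $u\in C(K)$ such that $u|_{e_{ij}^w}\in H^1(e_{ij}^w)$ for all $w\in W_*$, $(i,j)\in B$, each segment $e_{ij}^w$ being parametrised affinely by $[0,1]$. For $u,v\in\widetilde{\mathcal F}$ let $$\mathcal D^I_m(u,v)=\sum_{w\in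 W_{m-1}}\sum_{(i,j)\in B}\int_0^1(u|_{e_{ij}^w})'(v|_{e_{ij}^w})'\,dt\quad(m\ge1),\qquad Q^\Sigma_m(u,v)=\sum_{w\in W_m}Q_0(u\circ G_w,v\circ G_w)\quad(m\ge0),$$ where $Q_0(f,g)=\sum_{(i,j)\in B}(f(p_i)-f(p_j))(g(p_i)-g(p_j))$. A *sequence of matching pairs* is $\mathcal R=\{(r_m,\rho_m)\}_{m\ge1}$ with $r_m,\rho_m>0$ and $\frac53r_m+\rho_m=1$ for all $m$. Put $\delta_m=r_1\cdots r_m$ (with $\delta_0=1$), $\gamma_m=\delta_{m-1}\rho_m$ and $$\mathcal E_{\mathcal R,m}(u,v)=\frac1{\delta_m}Q_m^\Sigma(u,v)+\sum_{k=1}^m\frac1{\gamma_k}\mathcal D_k^I(u,v),\qquad \mathcal F_{\mathcal R}=\Big\{u\in\widetilde{\mathcal F}:\lim_{m\to\infty}\mathcal E_{\mathcal R,m}(u,u)<\infty\Big\}.$$ For $u,v\in\mathcal F_{\mathcal R}$ let $\mathcal E_{\mathcal R}(u,v)=\lim_m\mathcal E_{\mathcal R,m}(u,v)$, let $\mathcal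 E^I_{\mathcal R}(u,v)=\sum_{k\ge1}\frac1{\gamma_k}\mathcal D^I_k(u,v)$ (the line part) and $\mathcal E^\Sigma_{\mathcal R}=\mathcal E_{\mathcal R}-\mathcal E^I_{\mathcal R}$ (the SG part), and let $\mathcal F^I_{\mathcal R}=\{u\in\mathcal F_{\mathcal R}:\mathcal E^\Sigma_{\mathcal R}(u,u)=0\}$. Let $r_0=r_0(\mathcal E^I_{\mathcal R},\mathcal F^I_{\mathcal R})>0$ be the constant for which the trace of $(\mathcal E^I_{\mathcal R},\mathcal F^I_{\mathcal R})$ on $V_0$ is $r_0^{-1}Q_0$, that is, $\min\{\mathcal E^I_{\mathcal R}(v,v):v\in\mathcal F^I_{\mathcal R},\ v|_{V_0}=f\}=r_0^{-1}Q_0(f,f)$ for every $f:V_0\to\mathbb R$. The projection to the line part, $\mathcal L(\mathcal R)$, is the sequence of matching pairs $\mathcal R'$ with $(r_0\mathcal E^I_{\mathcal R},\mathcal F^I_{\mathcal R})=(\mathcal E_{\mathcal R'},\mathcal F_{\mathcal R'})$. **Theorem.** Let $\mathcal R=\{(r_m,\rho_m)\}_{m\ge1}$ be a sequence of matching pairs.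 Then $\mathcal L(\mathcal R)$ is well defined (the constant $r_0$ exists, and there is exactly one such $\mathcal R'$), and $$\mathcal L(\mathcal R)=\mathcal R\iff\sum_{m=1}^\infty\rho_m=\infty .$$ In particular, each of the following is equivalent to $\sum_{m=1}^\infty\rho_m=\infty$: $\mathcal E_{\mathcal R}=\mathcal E^I_{\mathcal R}$ on $\mathcal F_{\mathcal R}$; $(\mathcal E_{\mathcal R},\mathcal F_{\mathcal R})=(\mathcal E^I_{\mathcal R},\mathcal F^I_{\mathcal R})$; $\mathcal E^\Sigma_{\mathcal R}=0$ on $\mathcal F_{\mathcal R}$. -/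

import Mathlib

open Set Filter Topology MeasureTheory
open scoped ContDiff

noncomputable section

namespace SSG

/-! ### Geometry of the stretched Sierpinski gasket -/

/-- The Euclidean plane. -/
abbrev Plane : Type := EuclideanSpace ℝ (Fin 2)

/-- The parameters of the construction: the vertices of a regular triangle with centre `0` and
side length `1`, and the stretching parameter `α ∈ (0, 1)`.  The indices `1, 2, 3` are written
`0, 1, 2 : Fin 3`. -/
structure Config where
  p : Fin 3 → Plane
  sum_p : p 0 + p 1 + p 2 = 0
  dist_p : ∀ i j, i ≠ j → dist (p i) (p j) = 1
  α : ℝ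
  α_pos : 0 < α
  α_lt_one : α < 1

/-- The set of bonds `B = {(1,2), (2,3), (3,1)}`. -/
def bonds : Finset (Fin 3 × Fin 3) := {(0, 1), (1, 2), (2, 0)}

variable (S : Config)

/-- The contraction `G_i(x) = (1 - α)/2 (x - p_i) + p_i`. -/
def G (i : Fin 3) (x : Plane) : Plane := ((1 - S.α) / 2) • (x - S.p i) + S.p i

/-- `G_w = G_{w_1} ∘ ⋯ ∘ G_{w_m}` for a word `w = w_1 … w_m`. -/
def Gw : List (Fin 3) → Plane → Plane
  | [] => id
  | i :: w => G S i ∘ Gw w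

/-- The point `p_{ij} = G_i(p_j)`. -/
def corner (b : Fin 3 × Fin 3) : Plane := G S b.1 (S.p b.2)

/-- The line segment `e_{ij}` joining `p_{ij}` and `p_{ji}`. -/
def seg (b : Fin 3 × Fin 3) : Set Plane := segment ℝ (corner S b) (corner S b.swap)

/-- The stretched Sierpinski gasket.  It is the unique compact set `A` such that
`A = G_1(A) ∪ G_2(A) ∪ G_3(A) ∪ e_{12} ∪ e_{23} ∪ e_{31}`, see `isCompact_and_eq_iff` below. -/
def K : Set Plane := closure (⋃ w : List (Fin 3), ⋃ b ∈ bonds, Gw S w '' seg S b)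

lemma c_pos : 0 < (1 - S.α) / 2 := by linarith [S.α_lt_one]

lemma c_lt : (1 - S.α) / 2 < 1 / 2 := by linarith [S.α_pos]

lemma dist_G (i : Fin 3) (x y : Plane) :
    dist (G S i x) (G S i y) = ((1 - S.α) / 2) * dist x y := by
  simp only [G, dist_add_right, dist_smul₀, dist_sub_right, Real.norm_eq_abs,
    abs_of_pos (c_pos S)]

lemma dist_Gw (w : List (Fin 3)) (x y : Plane) :
    dist (Gw S w x) (Gw S w y) = ((1 - S.α) / 2) ^ w.length * dist x y := by
  induction w with
  | nil => simp [Gw]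
  | cons i w ih => simp only [Gw, Function.comp, dist_G, ih, List.length_cons, pow_succ]; ring

lemma continuous_G (i : Fin 3) : Continuous (G S i) := by
  unfold G; fun_prop

lemma isCompact_seg (b : Fin 3 × Fin 3) : IsCompact (seg S b) := by
  rw [seg, segment_eq_image]
  exact isCompact_Icc.image (by fun_prop)

/-- The right-hand side of the equation that characterises `K`. -/
def step (A : Set Plane) : Set Plane := (⋃ i, G S i '' A) ∪ ⋃ b ∈ bonds, seg S b

lemma isClosedMap_G (i : Fin 3) : IsClosedMap (G S i) := by
  have h : G S i = (Homeomorph.addRight (S.p i)) ∘ (Homeomorph.smulOfNeZero _ (c_pos S).ne')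
      ∘ (Homeomorph.subRight (S.p i)) := by
    ext1 x; rfl
  rw [h]
  exact (Homeomorph.isClosedMap _).comp
    ((Homeomorph.isClosedMap _).comp (Homeomorph.isClosedMap _))

lemma iUnion_words :
    (⋃ w : List (Fin 3), ⋃ b ∈ bonds, Gw S w '' seg S b)
      = step S (⋃ w : List (Fin 3), ⋃ b ∈ bonds, Gw S w '' seg S b) := by
  ext x
  simp only [step, mem_union, mem_iUnion, mem_image, exists_prop]
  constructor
  · rintro ⟨w, b, hb, y, hy, rfl⟩
    cases w with
    | nil => exact Or.inr ⟨b, hb, hy⟩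
    | cons i w => exact Or.inl ⟨i, Gw S w y, ⟨w, b, hb, y, hy, rfl⟩, rfl⟩
  · rintro (⟨i, _, ⟨w, b, hb, y, hy, rfl⟩, rfl⟩ | ⟨b, hb, hx⟩)
    · exact ⟨i :: w, b, hb, y, hy, rfl⟩
    · exact ⟨[], b, hb, x, hx, rfl⟩

lemma K_eq_step : K S = step S (K S) := by
  conv_lhs => rw [K, iUnion_words]
  rw [step, closure_union, closure_iUnion_of_finite]
  congr 1
  · refine iUnion_congr fun i => ?_
    exact ((isClosedMap_G S i).closure_image_eq_of_continuous (continuous_G S i) _)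
  · exact (bonds.finite_toSet.isClosed_biUnion fun b _ => (isCompact_seg S b).isClosed).closure_eq

lemma G_mem (i : Fin 3) {x : Plane} (hx : x ∈ K S) : G S i x ∈ K S := by
  rw [K_eq_step]
  exact Or.inl (mem_iUnion.2 ⟨i, mem_image_of_mem _ hx⟩)

lemma Gw_mem (w : List (Fin 3)) {x : Plane} (hx : x ∈ K S) : Gw S w x ∈ K S := by
  induction w with
  | nil => exact hx
  | cons i w ih => exact G_mem S i ih

lemma Gw_seg_subset (w : List (Fin 3)) {b : Fin 3 × Fin 3} (hb : b ∈ bonds) :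
    Gw S w '' seg S b ⊆ K S := fun _ hx =>
  subset_closure (mem_iUnion.2 ⟨w, mem_iUnion₂.2 ⟨b, hb, hx⟩⟩)

lemma K_nonempty : (K S).Nonempty :=
  ⟨corner S (0, 1), Gw_seg_subset S [] (b := (0, 1)) (by decide)
    ⟨_, left_mem_segment ℝ _ _, rfl⟩⟩

lemma Gw_replicate (i : Fin 3) (n : ℕ) : Gw S (List.replicate n i) (S.p i) = S.p i := by
  induction n with
  | zero => rfl
  | succ n ih => simp [List.replicate_succ, Gw, ih, G]

lemma tendsto_pow_c (C : ℝ) : Tendsto (fun n : ℕ => ((1 - S.α) / 2) ^ n * C) atTop (𝓝 0) := by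
  simpa using (tendsto_pow_atTop_nhds_zero_of_lt_one (c_pos S).le
    (by linarith [c_lt S])).mul_const C

lemma p_mem (i : Fin 3) : S.p i ∈ K S := by
  obtain ⟨x, hx⟩ := K_nonempty S
  refine isClosed_closure.mem_of_tendsto (b := atTop)
    (f := fun n : ℕ => Gw S (List.replicate n i) x) ?_
    (Eventually.of_forall fun n => Gw_mem S _ hx)
  rw [tendsto_iff_dist_tendsto_zero]
  refine (tendsto_pow_c S (dist x (S.p i))).congr fun n => ?_
  conv_rhs => rw [← Gw_replicate S i n]
  rw [dist_Gw, List.length_replicate]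

lemma subset_K_of_eq_step {A : Set Plane} (hA : Bornology.IsBounded A) (h : A = step S A) :
    A ⊆ K S := by
  obtain ⟨z, hz⟩ := K_nonempty S
  obtain ⟨C, hC⟩ := hA.subset_closedBall z
  have key : ∀ n : ℕ, ∀ x ∈ A, ∃ y ∈ K S, dist x y ≤ ((1 - S.α) / 2) ^ n * |C| := by
    intro n
    induction n with
    | zero => exact fun x hx => ⟨z, hz, by simpa using (hC hx).trans (le_abs_self C)⟩
    | succ n ih =>
      intro x hx
      rw [h] at hx
      rcases hx with hx | hx
      · obtain ⟨i, x', hx', rfl⟩ := mem_iUnion.1 hx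
        obtain ⟨y, hy, hd⟩ := ih x' hx'
        refine ⟨G S i y, G_mem S i hy, ?_⟩
        rw [dist_G, pow_succ', mul_assoc]
        exact mul_le_mul_of_nonneg_left hd (c_pos S).le
      · obtain ⟨b, hb, hx⟩ := mem_iUnion₂.1 hx
        refine ⟨x, Gw_seg_subset S [] hb ⟨x, hx, rfl⟩, ?_⟩
        rw [dist_self]
        exact mul_nonneg (pow_nonneg (c_pos S).le _) (abs_nonneg _)
  intro x hx
  choose y hy hd using fun n => key n x hx
  refine isClosed_closure.mem_of_tendsto (b := atTop) (f := y) ?_ (Eventually.of_forall hy)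
  rw [tendsto_iff_dist_tendsto_zero]
  exact squeeze_zero (fun _ => dist_nonneg) (fun n => by rw [dist_comm]; exact hd n)
    (tendsto_pow_c S |C|)

lemma K_subset_of_eq_step {A : Set Plane} (hA : IsClosed A) (h : A = step S A) : K S ⊆ A := by
  refine closure_minimal ?_ hA
  refine iUnion_subset fun w => iUnion₂_subset fun b hb => ?_
  induction w with
  | nil =>
    rintro _ ⟨x, hx, rfl⟩
    rw [h]
    exact Or.inr (mem_iUnion₂.2 ⟨b, hb, hx⟩)
  | cons i w ih =>
    rintro _ ⟨x, hx, rfl⟩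
    rw [h]
    exact Or.inl (mem_iUnion.2 ⟨i, _, ih ⟨x, hx, rfl⟩, rfl⟩)

lemma K_bounded : Bornology.IsBounded (K S) := by
  have hf : Bornology.IsBounded ((⋃ i, {S.p i}) ∪ ⋃ b ∈ bonds, seg S b) := by
    refine Bornology.IsBounded.union ?_ ?_
    · exact (finite_iUnion fun i => finite_singleton _).isBounded
    · exact (Bornology.isBounded_biUnion bonds.finite_toSet).2
        fun b _ => (isCompact_seg S b).isBounded
  obtain ⟨C, hC⟩ := hf.subset_closedBall 0
  have hstep : ∀ x ∈ Metric.closedBall (0 : Plane) C, ∀ i, G S i x ∈ Metric.closedBall 0 C := by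
    intro x hx i
    have hp : S.p i ∈ Metric.closedBall (0 : Plane) C := hC (Or.inl (mem_iUnion.2 ⟨i, rfl⟩))
    have e : G S i x = ((1 - S.α) / 2) • x + (1 - (1 - S.α) / 2) • S.p i := by
      rw [G, smul_sub, sub_smul, one_smul]; abel
    rw [e]
    exact convex_closedBall (0 : Plane) C hx hp (c_pos S).le (by linarith [c_lt S]) (by ring)
  refine (Metric.isBounded_closedBall (x := (0 : Plane)) (r := C)).subset ?_
  refine closure_minimal ?_ Metric.isClosed_closedBall
  refine iUnion_subset fun w => iUnion₂_subset fun b hb => ?_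
  rintro _ ⟨x, hx, rfl⟩
  induction w with
  | nil => exact hC (Or.inr (mem_iUnion₂.2 ⟨b, hb, hx⟩))
  | cons i w ih => exact hstep _ ih i

/-- `K` is the unique compact set with
`K = G_1(K) ∪ G_2(K) ∪ G_3(K) ∪ e_{12} ∪ e_{23} ∪ e_{31}`. -/
theorem isCompact_and_eq_iff (A : Set Plane) :
    (IsCompact A ∧ A = (⋃ i, G S i '' A) ∪ ⋃ b ∈ bonds, seg S b) ↔ A = K S := by
  constructor
  · rintro ⟨hA, h⟩
    exact (subset_K_of_eq_step S hA.isBounded h).antisymm (K_subset_of_eq_step S hA.isClosed h)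
  · rintro rfl
    exact ⟨Metric.isCompact_of_isClosed_isBounded isClosed_closure (K_bounded S), K_eq_step S⟩

/-- The point `G_w(p_i)` of `K`; the points with `w` of length `m` form `V_m`. -/
def vertex (w : List (Fin 3)) (i : Fin 3) : K S := ⟨Gw S w (S.p i), Gw_mem S w (p_mem S i)⟩

lemma G_lineMap (i : Fin 3) (x y : Plane) (t : ℝ) :
    G S i (AffineMap.lineMap x y t) = AffineMap.lineMap (G S i x) (G S i y) t := by
  simp only [G, AffineMap.lineMap_apply_module]
  module

lemma Gw_lineMap (w : List (Fin 3)) (x y : Plane) (t : ℝ) :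
    Gw S w (AffineMap.lineMap x y t) = AffineMap.lineMap (Gw S w x) (Gw S w y) t := by
  induction w with
  | nil => rfl
  | cons i w ih => simp only [Gw, Function.comp, ih, G_lineMap]

lemma lineMap_mem (w : List (Fin 3)) (b : bonds) (t : unitInterval) :
    AffineMap.lineMap (Gw S w (corner S b)) (Gw S w (corner S b.1.swap)) (t : ℝ) ∈ K S := by
  rw [← Gw_lineMap]
  refine Gw_seg_subset S w b.2 ⟨_, ?_, rfl⟩
  rw [seg, segment_eq_image_lineMap]
  exact mem_image_of_mem _ t.2

/-- The parametrisation `t ↦ (1 - t) G_w(p_{ij}) + t G_w(p_{ji})`, `t ∈ [0, 1]`, of the line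
segment `e_{ij}^w = G_w(e_{ij}) ⊆ K`. -/
def edge (w : List (Fin 3)) (b : bonds) (t : unitInterval) : K S :=
  ⟨AffineMap.lineMap (Gw S w (corner S b)) (Gw S w (corner S b.1.swap)) (t : ℝ),
    lineMap_mem S w b t⟩

/-! ### The Sobolev space `H¹([0, 1])` and Dirichlet integrals -/

/-- `g` is the derivative of `f` on `(0, 1)` in the sense of distributions, and `g ∈ L²`. -/
def IsL2WeakDeriv (f g : ℝ → ℝ) : Prop :=
  LocallyIntegrableOn f (Ioo 0 1) ∧ MemLp g 2 (volume.restrict (Ioo 0 1)) ∧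
    ∀ φ : ℝ → ℝ, ContDiff ℝ ∞ φ → HasCompactSupport φ → tsupport φ ⊆ Ioo 0 1 →
      ∫ t in Ioo (0 : ℝ) 1, f t * deriv φ t = -∫ t in Ioo (0 : ℝ) 1, g t * φ t

/-- `f ∈ H¹([0, 1])`. -/
def MemH1 (f : unitInterval → ℝ) : Prop :=
  ∃ g : ℝ → ℝ, IsL2WeakDeriv (IccExtend zero_le_one f) g

open Classical in
/-- The (a.e. unique) weak derivative of `f ∈ H¹([0, 1])`. -/
def weakDeriv (f : unitInterval → ℝ) : ℝ → ℝ :=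
  if h : MemH1 f then h.choose else 0

/-- The Dirichlet integral `∫₀¹ f' g'`. -/
def dirichlet (f g : unitInterval → ℝ) : ℝ :=
  ∫ t in Ioo (0 : ℝ) 1, weakDeriv f t * weakDeriv g t

/-- The space `𝓕~` of the continuous functions on `K` that are `H¹` on each segment `e_{ij}^w`. -/
def FTilde : Set (K S → ℝ) :=
  {u | Continuous u ∧ ∀ (w : List (Fin 3)) (b : bonds), MemH1 (u ∘ edge S w b)}

/-- The form `𝓓^I_{k+1}(u, v)`: the sum of the Dirichlet integrals over `e_{ij}^w`, `w ∈ W_k`. -/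
def DI (k : ℕ) (u v : K S → ℝ) : ℝ :=
  ∑ w : Fin k → Fin 3, ∑ b : bonds,
    dirichlet (u ∘ edge S (List.ofFn w) b) (v ∘ edge S (List.ofFn w) b)

/-- The form `Q_0` on `ℓ(V_0)`, where `f i` stands for the value at `p_i`. -/
def Q0 (f g : Fin 3 → ℝ) : ℝ := ∑ b ∈ bonds, (f b.1 - f b.2) * (g b.1 - g b.2)

/-- The form `Q_m^Σ(u, v) = ∑_{w ∈ W_m} Q_0(u ∘ G_w, v ∘ G_w)`. -/
def QSigma (m : ℕ) (u v : K S → ℝ) : ℝ :=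
  ∑ w : Fin m → Fin 3,
    Q0 (fun i => u (vertex S (List.ofFn w) i)) (fun i => v (vertex S (List.ofFn w) i))

/-! ### Forms with a domain -/

/-- A pair `(𝓔, 𝓕)`: a set `𝓕` of functions on `X` and a form `𝓔`, of which only the values on
`𝓕 × 𝓕` are meaningful. -/
structure FormPair (X : Type) where
  form : (X → ℝ) → (X → ℝ) → ℝ
  dom : Set (X → ℝ)

/-- Equality of pairs: the domains agree, and the forms agree on the common domain. -/
def FormPair.Same {X : Type} (A B : FormPair X) : Prop :=
  A.dom = B.dom ∧ ∀ u ∈ A.dom, ∀ v ∈ A.dom, A.form u v = B.form u v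

/-- The pair `(c 𝓔, 𝓕)`. -/
def FormPair.scale {X : Type} (c : ℝ) (A : FormPair X) : FormPair X where
  form := fun u v => c * A.form u v
  dom := A.dom

/-- `c = r_0(𝓔, 𝓕)`: the trace of `(𝓔, 𝓕)` on `V_0` is `c⁻¹ Q_0`, that is, for every
`f ∈ ℓ(V_0)` the minimum of `𝓔(v, v)` over the `v ∈ 𝓕` with `v = f` on `V_0` exists and equals
`c⁻¹ Q_0(f, f)`. -/
def IsR0 (A : FormPair (K S)) (c : ℝ) : Prop :=
  0 < c ∧ ∀ f : Fin 3 → ℝ,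
    IsLeast {e | ∃ v ∈ A.dom, (∀ i, v (vertex S [] i) = f i) ∧ e = A.form v v} (c⁻¹ * Q0 f f)

/-! ### Forms derived from matching pairs -/

/-- A matching pair `(r, ρ)` of resistances. -/
@[ext]
structure MatchingPair where
  r : ℝ
  ρ : ℝ
  r_pos : 0 < r
  ρ_pos : 0 < ρ
  matching : 5 / 3 * r + ρ = 1

/-- Sequences of matching pairs; the pair `(r_m, ρ_m)`, `m ≥ 1`, is the term with index `m - 1`. -/
abbrev MPSeq : Type := ℕ → MatchingPair

instance : Nonempty MatchingPair := ⟨⟨3 / 10, 1 / 2, by norm_num, by norm_num, by norm_num⟩⟩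

/-- `∑_{m ≥ 1} ρ_m = ∞`. -/
def SumRhoInfinite (R : MPSeq) : Prop :=
  Tendsto (fun n => ∑ k ∈ Finset.range n, (R k).ρ) atTop atTop

/-- `δ_m = r_1 ⋯ r_m`. -/
def delta (R : MPSeq) (m : ℕ) : ℝ := ∏ k ∈ Finset.range m, (R k).r

/-- `γ_{k+1} = δ_k ρ_{k+1}`. -/
def gamma (R : MPSeq) (k : ℕ) : ℝ := delta R k * (R k).ρ

/-- `𝓔_{R,m}(u, v) = δ_m⁻¹ Q_m^Σ(u, v) + ∑_{k=1}^m γ_k⁻¹ 𝓓_k^I(u, v)`. -/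
def energyApprox (R : MPSeq) (m : ℕ) (u v : K S → ℝ) : ℝ :=
  (delta R m)⁻¹ * QSigma S m u v + ∑ k ∈ Finset.range m, (gamma R k)⁻¹ * DI S k u v

/-- `(𝓔_R, 𝓕_R)`: the limit of the forms `𝓔_{R,m}`, on the functions in `𝓕~` for which
`lim 𝓔_{R,m}(u, u)` is finite. -/
def energy (R : MPSeq) : FormPair (K S) where
  form := fun u v => limUnder atTop fun m => energyApprox S R m u v
  dom := {u | u ∈ FTilde S ∧ ∃ l : ℝ, Tendsto (fun m => energyApprox S R m u u) atTop (𝓝 l)}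

/-- The line part `𝓔_R^I(u, v) = ∑_{k ≥ 1} γ_k⁻¹ 𝓓_k^I(u, v)`, for `u, v ∈ 𝓕_R`. -/
def lineForm (R : MPSeq) (u v : K S → ℝ) : ℝ := ∑' k, (gamma R k)⁻¹ * DI S k u v

/-- The SG part `𝓔_R^Σ = 𝓔_R - 𝓔_R^I`, for `u, v ∈ 𝓕_R`. -/
def sgForm (R : MPSeq) (u v : K S → ℝ) : ℝ := (energy S R).form u v - lineForm S R u v

/-- `(𝓔_R^I, 𝓕_R^I)`, where `𝓕_R^I = {u ∈ 𝓕_R | 𝓔_R^Σ(u, u) = 0}`. -/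
def lineEnergy (R : MPSeq) : FormPair (K S) where
  form := lineForm S R
  dom := {u | u ∈ (energy S R).dom ∧ sgForm S R u u = 0}

/-- `R'` satisfies `(r_0 𝓔_R^I, 𝓕_R^I) = (𝓔_{R'}, 𝓕_{R'})` with `r_0 = r_0(𝓔_R^I, 𝓕_R^I)`. -/
def IsLineProjection (R R' : MPSeq) : Prop :=
  ∃ c : ℝ, IsR0 S (lineEnergy S R) c ∧ ((lineEnergy S R).scale c).Same (energy S R')

/-- The projection `L` to the line part: `L(R)` is the unique `R'` with
`(r_0 𝓔_R^I, 𝓕_R^I) = (𝓔_{R'}, 𝓕_{R'})`. -/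
def lineProjection (R : MPSeq) : MPSeq := Classical.epsilon (IsLineProjection S R)

end SSG

end

/-! A cell is a network of three subcells of resistance `r` and three bonds of resistance `ρ`,
equivalent to a single cell of resistance `5 / 3 * r + ρ`. For a matching pair, a harmonic function
leaves the share `5 / 3 * r = 1 - ρ` of its energy on the subcells. After `m` levels the share `∏ (1
- ρ_k)` is left on the cells. Its limit `sgShare R` vanishes exactly when `∑ ρ_k = ∞`
(`sgShare_eq_zero_iff`). If the limit is positive, harmonic functions with nonconstant boundary
values have a nonzero SG part (`sgShare_eq_zero_of_sgForm`).

The converse and the projection rest on one comparison. The recursion `5 / 3 * (r_k * b_{k+1}) + ρ_k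
= b_k` has the solutions `b_k = 1 + C / cellShare R k`, and for every positive solution the quantity
`(b_m δ_m)⁻¹ Q_m + linePartial` increases in `m` (`monotone_cell_add_line`). If its cell term tends
to `0` for every `C > -sgShare R`, its limit is the line energy, and letting `C` decrease to
`-sgShare R` bounds cell energies by tails of line energies (`cell_le_line_tail`). When `sgShare R =
0`, each `C > 0` makes `b_m → ∞`, which kills the bounded cell term, so every function of finite
energy has SG part zero (`hasLineEnergy_of_mem_dom`).

In general the smallest positive solution `lineResistance R` renormalises `R` to `lineSeq R`, whose
`gamma` is a constant multiple of that of `R` and whose `sgShare` is `0`. Hence the rescaled line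
part of `R` is the whole energy of `lineSeq R` (`same_lineSeq`). Since the energy determines its
sequence (`eq_of_energy_same`), `lineSeq R` is the projection, and it equals `R` exactly when
`sgShare R = 0`. -/

noncomputable section
namespace SSG

/-! ### Functions in `H¹([0, 1])` -/

lemma weakDeriv_spec {f : unitInterval → ℝ} (h : MemH1 f) :
    IsL2WeakDeriv (IccExtend zero_le_one f) (weakDeriv f) := by
  rw [weakDeriv, dif_pos h]
  exact h.choose_spec

lemma memLp_weakDeriv {f : unitInterval → ℝ} (h : MemH1 f) :
    MemLp (weakDeriv f) 2 (volume.restrict (Ioo 0 1)) :=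
  (weakDeriv_spec h).2.1

lemma dirichlet_self_nonneg (f : unitInterval → ℝ) : 0 ≤ dirichlet f f :=
  integral_nonneg fun _ => mul_self_nonneg _

lemma abs_dirichlet_le {f g : unitInterval → ℝ} (hf : MemH1 f) (hg : MemH1 g) :
    |dirichlet f g| ≤ (dirichlet f f + dirichlet g g) / 2 := by
  have h1 : Integrable (fun t => weakDeriv f t * weakDeriv f t)
      (volume.restrict (Ioo (0 : ℝ) 1)) := (memLp_weakDeriv hf).integrable_mul (memLp_weakDeriv hf)
  have h2 : Integrable (fun t => weakDeriv g t * weakDeriv g t)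
      (volume.restrict (Ioo (0 : ℝ) 1)) := (memLp_weakDeriv hg).integrable_mul (memLp_weakDeriv hg)
  have h : |dirichlet f g| ≤ ∫ t in Ioo (0 : ℝ) 1,
      (weakDeriv f t * weakDeriv f t + weakDeriv g t * weakDeriv g t) / 2 := by
    rw [← Real.norm_eq_abs]
    refine norm_integral_le_of_norm_le ((h1.add h2).div_const 2) (Eventually.of_forall fun t => ?_)
    rw [Real.norm_eq_abs, abs_le]
    constructor <;> nlinarith [sq_nonneg (weakDeriv f t - weakDeriv g t),
      sq_nonneg (weakDeriv f t + weakDeriv g t)]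
  rwa [integral_div, integral_add h1 h2] at h

instance : IsProbabilityMeasure (volume.restrict (Ioo (0 : ℝ) 1)) :=
  ⟨by simp⟩

/-- Cauchy–Schwarz on a probability space, from integrating `(|g| - m) ^ 2 ≥ 0` with `m` the mean of
`|g|`. -/
lemma sq_integral_abs_le {g : ℝ → ℝ} (hg : MemLp g 2 (volume.restrict (Ioo 0 1))) :
    (∫ t in Ioo (0 : ℝ) 1, |g t|) ^ 2 ≤ ∫ t in Ioo (0 : ℝ) 1, g t * g t := by
  have h1 : Integrable (fun t => |g t|) (volume.restrict (Ioo (0 : ℝ) 1)) :=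
    (hg.integrable (by norm_num)).abs
  have h2 : Integrable (fun t => g t * g t) (volume.restrict (Ioo (0 : ℝ) 1)) :=
    hg.integrable_mul hg
  set m := ∫ t in Ioo (0 : ℝ) 1, |g t| with hm
  have h : 0 ≤ ∫ t in Ioo (0 : ℝ) 1, ((g t * g t - 2 * m * |g t|) + m ^ 2) := by
    refine integral_nonneg fun t => ?_
    have := sq_abs (g t)
    simp only [Pi.zero_apply]
    nlinarith [sq_nonneg (|g t| - m)]
  have h3 : Integrable (fun t => 2 * m * |g t|) (volume.restrict (Ioo (0 : ℝ) 1)) :=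
    h1.const_mul _
  have h4 : Integrable (fun t => g t * g t - 2 * m * |g t|) (volume.restrict (Ioo (0 : ℝ) 1)) :=
    h2.sub h3
  rw [integral_add h4 (integrable_const _), integral_sub h2 h3, integral_const_mul, ← hm, integral_const] at h
  simp only [measureReal_def, measure_univ, ENNReal.toReal_one, one_smul] at h
  nlinarith

/-- A smooth step that rises from `0` to `1` on `[d / 2, d]`. -/
def smoothStep (d t : ℝ) : ℝ := Real.smoothTransition (2 / d * t - 1)

lemma contDiff_smoothStep (d : ℝ) : ContDiff ℝ ∞ (smoothStep d) :=
  Real.smoothTransition.contDiff.comp (by fun_prop)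

lemma smoothStep_eq_zero {d t : ℝ} (hd : 0 < d) (ht : t ≤ d / 2) : smoothStep d t = 0 := by
  refine Real.smoothTransition.zero_of_nonpos ?_
  have : 2 / d * t ≤ 2 / d * (d / 2) := by gcongr
  have e : 2 / d * (d / 2) = 1 := by field_simp
  linarith

lemma smoothStep_eq_one {d t : ℝ} (hd : 0 < d) (ht : d ≤ t) : smoothStep d t = 1 := by
  refine Real.smoothTransition.one_of_one_le ?_
  have : 2 / d * d ≤ 2 / d * t := by gcongr
  have e : 2 / d * d = 2 := by field_simp
  linarith

lemma monotone_smoothStep {d : ℝ} (hd : 0 < d) : Monotone (smoothStep d) := by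
  intro s t h
  have hm : Monotone Real.smoothTransition := Real.smoothTransition.monotone
  exact hm (by gcongr)

lemma deriv_smoothStep_nonneg {d : ℝ} (hd : 0 < d) (t : ℝ) : 0 ≤ deriv (smoothStep d) t :=
  (monotone_smoothStep hd).deriv_nonneg

lemma deriv_smoothStep_eq_zero {d t : ℝ} (hd : 0 < d) (ht : d < t) :
    deriv (smoothStep d) t = 0 := by
  have : smoothStep d =ᶠ[𝓝 t] fun _ => 1 := by
    filter_upwards [lt_mem_nhds ht] with s hs using smoothStep_eq_one hd hs.le
  rw [this.deriv_eq, deriv_const]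

/-- The derivative of `smoothStep d` is nonnegative, has integral `1` over `[0, 1]` and vanishes
beyond `d`, so integrating against it averages `H` near `0`. -/
lemma abs_integral_mul_deriv_smoothStep_sub_le {H : ℝ → ℝ} (hH : Continuous H) {d ε : ℝ}
    (hd : 0 < d) (hd1 : d ≤ 1) (h : ∀ t ∈ Icc 0 d, |H t - H 0| ≤ ε) :
    |(∫ t in (0 : ℝ)..1, H t * deriv (smoothStep d) t) - H 0| ≤ ε := by
  have hc : Continuous (deriv (smoothStep d)) :=
    (contDiff_smoothStep d).continuous_deriv (by simp)
  have hI : ∫ t in (0 : ℝ)..1, deriv (smoothStep d) t = 1 := by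
    rw [intervalIntegral.integral_deriv_eq_sub
      (fun t _ => ((contDiff_smoothStep d).differentiable (by simp)) t)
      (hc.intervalIntegrable _ _), smoothStep_eq_one hd hd1,
      smoothStep_eq_zero hd (by linarith)]
    norm_num
  have e : (∫ t in (0 : ℝ)..1, H t * deriv (smoothStep d) t) - H 0
      = ∫ t in (0 : ℝ)..1, (H t - H 0) * deriv (smoothStep d) t := by
    simp only [sub_mul]
    have i₁ : Continuous fun t => H t * deriv (smoothStep d) t := hH.mul hc
    have i₂ : Continuous fun t => H 0 * deriv (smoothStep d) t := continuous_const.mul hc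
    rw [intervalIntegral.integral_sub (i₁.intervalIntegrable _ _)
      (i₂.intervalIntegrable _ _), intervalIntegral.integral_const_mul, hI,
      mul_one]
  have e2 : ε = ∫ t in (0 : ℝ)..1, ε * deriv (smoothStep d) t := by
    rw [intervalIntegral.integral_const_mul, hI, mul_one]
  have i : Continuous fun t => ε * deriv (smoothStep d) t := continuous_const.mul hc
  rw [e, ← Real.norm_eq_abs]
  conv_rhs => rw [e2]
  refine intervalIntegral.norm_integral_le_of_norm_le zero_le_one
    (Eventually.of_forall fun t ht => ?_) (i.intervalIntegrable _ _)
  rw [Real.norm_eq_abs, abs_mul, abs_of_nonneg (deriv_smoothStep_nonneg hd t)]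
  rcases le_or_gt t d with htd | htd
  · exact mul_le_mul_of_nonneg_right (h t ⟨ht.1.le, htd⟩) (deriv_smoothStep_nonneg hd t)
  · simp [deriv_smoothStep_eq_zero hd htd]

lemma exists_near_zero {H : ℝ → ℝ} (hH : Continuous H) {ε : ℝ} (hε : 0 < ε) :
    ∃ d > 0, ∀ t ∈ Icc 0 d, |H t - H 0| ≤ ε := by
  obtain ⟨d, hd, h⟩ := Metric.continuousAt_iff.1 (hH.continuousAt (x := 0)) ε hε
  refine ⟨d / 2, by positivity, fun t ht => ?_⟩
  have := @h t (by rw [Real.dist_eq, sub_zero, abs_of_nonneg ht.1]; linarith [ht.2])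
  exact this.le

/-- The weak derivative is tested against a plateau that rises next to `0` and falls next to `1`: `∫
F φ'` is within `ε` of `F 0 - F 1`, while `|φ| ≤ 1` bounds the other side. This avoids passing
through absolute continuity. -/
lemma abs_sub_le_integral_weakDeriv {F g : ℝ → ℝ} (hF : Continuous F) (h : IsL2WeakDeriv F g) :
    |F 1 - F 0| ≤ ∫ t in Ioo (0 : ℝ) 1, |g t| := by
  refine le_of_forall_pos_le_add fun ε hε => ?_
  have hF' : Continuous fun t => F (1 - t) := by fun_prop
  obtain ⟨d₁, hd₁, h₁⟩ := exists_near_zero hF (half_pos hε)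
  obtain ⟨d₂, hd₂, h₂⟩ := exists_near_zero hF' (half_pos hε)
  -- The cap `1 / 4` keeps the two ramps of the plateau apart.
  set d := min (min d₁ d₂) (1 / 4) with hd_def
  have hd : 0 < d := by positivity
  have hd4 : d ≤ 1 / 4 := min_le_right _ _
  have k₁ := abs_integral_mul_deriv_smoothStep_sub_le hF hd (by linarith) fun t ht =>
    h₁ t ⟨ht.1, ht.2.trans ((min_le_left _ _).trans (min_le_left _ _))⟩
  have k₂ := abs_integral_mul_deriv_smoothStep_sub_le hF' hd (by linarith) fun t ht =>
    h₂ t ⟨ht.1, ht.2.trans ((min_le_left _ _).trans (min_le_right _ _))⟩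
  have hs := contDiff_smoothStep d
  have hds := hs.differentiable (by simp)
  have hc : Continuous (deriv (smoothStep d)) := hs.continuous_deriv (by simp)
  have hc' : Continuous fun t => deriv (smoothStep d) (1 - t) := by fun_prop
  have e₂ : ∫ t in (0 : ℝ)..1, F (1 - t) * deriv (smoothStep d) t
      = ∫ t in (0 : ℝ)..1, F t * deriv (smoothStep d) (1 - t) := by
    have := intervalIntegral.integral_comp_sub_left (a := 0) (b := 1)
      (fun t => F t * deriv (smoothStep d) (1 - t)) 1
    simpa using this
  let φ : ℝ → ℝ := fun t => smoothStep d t + smoothStep d (1 - t) - 1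
  have hφ : ContDiff ℝ ∞ φ :=
    (hs.add (hs.comp (by fun_prop : ContDiff ℝ ∞ fun t : ℝ => 1 - t))).sub contDiff_const
  have hφd : ∀ t, deriv φ t = deriv (smoothStep d) t - deriv (smoothStep d) (1 - t) := by
    intro t
    have a := (hds t).hasDerivAt
    have b := (hds (1 - t)).hasDerivAt.comp t ((hasDerivAt_id t).const_sub 1)
    have := ((a.add b).sub_const 1).deriv
    simpa [φ, Function.comp_def, sub_eq_add_neg] using this
  have hφs : tsupport φ ⊆ Icc (d / 2) (1 - d / 2) := by
    refine closure_minimal (fun t ht => ?_) isClosed_Icc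
    by_contra hn
    refine ht ?_
    rcases not_and_or.1 hn with hn | hn
    · simp only [φ, smoothStep_eq_zero hd (not_le.1 hn).le,
        smoothStep_eq_one (t := 1 - t) hd (by linarith)]
      norm_num
    · simp only [φ, smoothStep_eq_zero (t := 1 - t) hd (by linarith),
        smoothStep_eq_one (t := t) hd (by linarith)]
      norm_num
  have hφ1 : ∀ t, |φ t| ≤ 1 := by
    intro t
    have a : ∀ t, 0 ≤ smoothStep d t ∧ smoothStep d t ≤ 1 := fun t =>
      ⟨Real.smoothTransition.nonneg _, Real.smoothTransition.le_one _⟩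
    have b := a t
    have c := a (1 - t)
    rw [abs_le]
    constructor <;> simp only [φ] <;> linarith
  have key := h.2.2 φ hφ (HasCompactSupport.of_support_subset_isCompact isCompact_Icc
    (subset_closure.trans hφs)) (hφs.trans fun t ht => ⟨by linarith [ht.1], by linarith [ht.2]⟩)
  have hI : ∫ t in Ioo (0 : ℝ) 1, F t * deriv φ t
      = (∫ t in (0 : ℝ)..1, F t * deriv (smoothStep d) t)
        - ∫ t in (0 : ℝ)..1, F t * deriv (smoothStep d) (1 - t) := by
    have i₁ : Continuous fun t => F t * deriv (smoothStep d) t := hF.mul hc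
    have i₂ : Continuous fun t => F t * deriv (smoothStep d) (1 - t) := hF.mul hc'
    rw [← intervalIntegral.integral_sub (i₁.intervalIntegrable _ _)
      (i₂.intervalIntegrable _ _), intervalIntegral.integral_of_le zero_le_one,
      integral_Ioc_eq_integral_Ioo]
    simp only [hφd, mul_sub]
  have hJ : |∫ t in Ioo (0 : ℝ) 1, g t * φ t| ≤ ∫ t in Ioo (0 : ℝ) 1, |g t| := by
    rw [← Real.norm_eq_abs]
    refine norm_integral_le_of_norm_le (h.2.1.integrable (by norm_num)).abs
      (Eventually.of_forall fun t => ?_)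
    rw [Real.norm_eq_abs, abs_mul]
    exact mul_le_of_le_one_right (abs_nonneg _) (hφ1 t)
  rw [hI] at key
  rw [e₂] at k₂
  simp only [sub_zero] at k₂
  rw [abs_le] at *
  constructor <;> linarith [k₁.1, k₁.2, k₂.1, k₂.2, hJ.1, hJ.2]

/-- Allows each segment to be compared with a unit resistor between its endpoints; affine functions
attain equality. -/
lemma sq_sub_le_dirichlet {f : unitInterval → ℝ} (hc : Continuous f) (h : MemH1 f) :
    (f 0 - f 1) ^ 2 ≤ dirichlet f f := by
  have h1 := abs_sub_le_integral_weakDeriv (hc.Icc_extend' (h := zero_le_one)) (weakDeriv_spec h)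
  have e0 : IccExtend zero_le_one f 0 = f 0 := IccExtend_left _ _
  have e1 : IccExtend zero_le_one f 1 = f 1 := IccExtend_right _ _
  rw [e0, e1, abs_sub_comm] at h1
  refine le_trans ?_ (sq_integral_abs_le (memLp_weakDeriv h))
  rw [← sq_abs]
  gcongr

lemma isL2WeakDeriv_affine {f : unitInterval → ℝ} {a b : ℝ}
    (h : ∀ t : unitInterval, f t = (1 - t) * a + t * b) :
    IsL2WeakDeriv (IccExtend zero_le_one f) fun _ => b - a := by
  have hc : Continuous f := by
    rw [show f = fun t : unitInterval => (1 - (t : ℝ)) * a + t * b from funext h]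
    fun_prop
  refine ⟨(hc.Icc_extend' (h := zero_le_one)).locallyIntegrable.locallyIntegrableOn _,
    memLp_const _, fun φ hφ _ hs => ?_⟩
  have e : ∀ t ∈ Ioo (0 : ℝ) 1, IccExtend zero_le_one f t * deriv φ t
      = ((1 - t) * a + t * b) * deriv φ t := by
    intro t ht
    rw [IccExtend_of_mem _ _ (Ioo_subset_Icc_self ht), h]
  have h0 : φ 0 = 0 := image_eq_zero_of_notMem_tsupport fun h => lt_irrefl _ (hs h).1
  have h1 : φ 1 = 0 := image_eq_zero_of_notMem_tsupport fun h => lt_irrefl _ (hs h).2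
  rw [setIntegral_congr_fun measurableSet_Ioo e, ← integral_Ioc_eq_integral_Ioo,
    ← integral_Ioc_eq_integral_Ioo, ← intervalIntegral.integral_of_le zero_le_one,
    ← intervalIntegral.integral_of_le zero_le_one,
    intervalIntegral.integral_mul_deriv_eq_deriv_mul (u' := fun _ => b - a) (v := φ)
      (fun t _ => ?_) (fun t _ => (hφ.differentiable (by simp) t).hasDerivAt)
      intervalIntegrable_const ((hφ.continuous_deriv (by simp)).intervalIntegrable _ _)]
  · simp [h0, h1]
  · have : HasDerivAt (fun t => (1 - t) * a + t * b) (-1 * a + 1 * b) t :=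
      (((hasDerivAt_id t).const_sub 1).mul_const a).add ((hasDerivAt_id t).mul_const b)
    rwa [neg_one_mul, one_mul, neg_add_eq_sub] at this

/-- `weakDeriv` is an arbitrary choice, so evaluating a Dirichlet integral from an explicit
derivative needs uniqueness almost everywhere. -/
lemma IsL2WeakDeriv.ae_eq {F g g' : ℝ → ℝ} (h : IsL2WeakDeriv F g) (h' : IsL2WeakDeriv F g') :
    ∀ᵐ t ∂volume.restrict (Ioo (0 : ℝ) 1), g t = g' t := by
  have hi := h.2.1.integrable (by norm_num)
  have hi' := h'.2.1.integrable (by norm_num)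
  rw [ae_restrict_iff' measurableSet_Ioo]
  have := isOpen_Ioo.ae_eq_zero_of_integral_contDiff_smul_eq_zero (μ := volume)
    (U := Ioo (0 : ℝ) 1) (f := fun t => g t - g' t)
    ((show IntegrableOn (fun t => g t - g' t) (Ioo (0 : ℝ) 1) volume from
      hi.sub hi').locallyIntegrableOn) fun φ hφ hc hs => ?_
  · filter_upwards [this] with t ht hm using sub_eq_zero.1 (ht hm)
  · have e : ∫ t, φ t • (g t - g' t) = ∫ t in Ioo (0 : ℝ) 1, φ t • (g t - g' t) := by
      refine (setIntegral_eq_integral_of_forall_compl_eq_zero fun t ht => ?_).symm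
      rw [image_eq_zero_of_notMem_tsupport fun h => ht (hs h), zero_smul]
    obtain ⟨C, hC⟩ := hc.exists_bound_of_continuous hφ.continuous
    have b : ∀ {k : ℝ → ℝ}, Integrable k (volume.restrict (Ioo (0 : ℝ) 1)) →
        Integrable (fun t => k t * φ t) (volume.restrict (Ioo (0 : ℝ) 1)) := fun hk =>
      hk.mul_bdd hφ.continuous.aestronglyMeasurable (Eventually.of_forall hC)
    have k := (h.2.2 φ hφ hc hs).symm.trans (h'.2.2 φ hφ hc hs)
    rw [e]
    simp only [smul_eq_mul, mul_comm (φ _), sub_mul]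
    rw [integral_sub (b hi) (b hi')]
    linarith

lemma memH1_of_affine {f : unitInterval → ℝ} {a b : ℝ}
    (h : ∀ t : unitInterval, f t = (1 - t) * a + t * b) : MemH1 f :=
  ⟨_, isL2WeakDeriv_affine h⟩

lemma dirichlet_self_of_affine {f : unitInterval → ℝ} {a b : ℝ}
    (h : ∀ t : unitInterval, f t = (1 - t) * a + t * b) : dirichlet f f = (a - b) ^ 2 := by
  have hae := (weakDeriv_spec (memH1_of_affine h)).ae_eq (isL2WeakDeriv_affine h)
  have : dirichlet f f = ∫ _ in Ioo (0 : ℝ) 1, (b - a) * (b - a) :=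
    integral_congr_ae (hae.mono fun t ht => by simp only [ht])
  rw [this, integral_const]
  simp only [measureReal_def, measure_univ, ENNReal.toReal_one, one_smul]
  ring

end SSG
end

noncomputable section
namespace SSG

/-! ### The network on `V_1` -/

lemma Q0_self (f : Fin 3 → ℝ) :
    Q0 f f = (f 0 - f 1) ^ 2 + (f 1 - f 2) ^ 2 + (f 2 - f 0) ^ 2 := by
  simp [Q0, bonds]; ring

lemma Q0_self_nonneg (f : Fin 3 → ℝ) : 0 ≤ Q0 f f := by
  rw [Q0_self]; positivity

lemma abs_Q0_le (f g : Fin 3 → ℝ) : |Q0 f g| ≤ (Q0 f f + Q0 g g) / 2 := by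
  simp only [Q0, ← Finset.sum_add_distrib, Finset.sum_div]
  refine (Finset.abs_sum_le_sum_abs _ _).trans (Finset.sum_le_sum fun b _ => ?_)
  rw [abs_le]
  constructor <;> nlinarith [sq_nonneg ((f b.1 - f b.2) - (g b.1 - g b.2)),
    sq_nonneg ((f b.1 - f b.2) + (g b.1 - g b.2))]

/-- The values at `G_i(p_j)` of the function on `V_1` that is harmonic when the cells have
resistance `s`, the bonds `1 - 5 / 3 * s`, and the values at `p_j` are `f j`. -/
def harmonicStep (s : ℝ) (i : Fin 3) (f : Fin 3 → ℝ) (j : Fin 3) : ℝ :=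
  if j = i then f i else f i - s / 3 * (4 * f i - f j - (f 0 + f 1 + f 2))

lemma harmonicStep_self (s : ℝ) (i : Fin 3) (f : Fin 3 → ℝ) : harmonicStep s i f i = f i :=
  if_pos rfl

lemma sum_Q0_harmonicStep (s : ℝ) (f : Fin 3 → ℝ) :
    ∑ i, Q0 (harmonicStep s i f) (harmonicStep s i f) = 5 / 3 * s ^ 2 * Q0 f f := by
  simp [Q0_self, harmonicStep, Fin.sum_univ_three]
  ring

lemma harmonicStep_sub (s : ℝ) (f : Fin 3 → ℝ) {b : Fin 3 × Fin 3} (hb : b ∈ bonds) :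
    harmonicStep s b.1 f b.2 - harmonicStep s b.2 f b.1 = (1 - 5 / 3 * s) * (f b.1 - f b.2) := by
  simp only [bonds, Finset.mem_insert, Finset.mem_singleton] at hb
  rcases hb with rfl | rfl | rfl <;> simp [harmonicStep] <;> ring

/-- Dirichlet's principle by completing the square: the deviation `d` from the harmonic extension
vanishes at the boundary vertices, so the cross term drops out and the excess energy is that of `d`.
-/
lemma Q0_le_network {s ρ : ℝ} (hs : 0 < s) (hρ : 0 < ρ) (f : Fin 3 → ℝ) (g : Fin 3 → Fin 3 → ℝ)
    (hg : ∀ i, g i i = f i) :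
    (5 / 3 * s + ρ)⁻¹ * Q0 f f ≤ s⁻¹ * ∑ i, Q0 (g i) (g i)
      + ρ⁻¹ * ∑ b ∈ bonds, (g b.1 b.2 - g b.2 b.1) ^ 2 := by
  have ht : 0 < 5 / 3 * s + ρ := by positivity
  -- The minimiser depends only on the ratio of the resistances; dividing `s` by the total `5 / 3 *
  -- s + ρ` puts it in the normalisation of `harmonicStep`.
  set d : Fin 3 → Fin 3 → ℝ := fun i j => g i j - harmonicStep (s / (5 / 3 * s + ρ)) i f j with hd
  have hg' : ∀ i j, g i j = d i j + harmonicStep (s / (5 / 3 * s + ρ)) i f j := by simp [hd]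
  have hdi : ∀ i, d i i = 0 := by simp [hd, hg, harmonicStep_self]
  have key : s⁻¹ * ∑ i, Q0 (g i) (g i) + ρ⁻¹ * ∑ b ∈ bonds, (g b.1 b.2 - g b.2 b.1) ^ 2
      - (5 / 3 * s + ρ)⁻¹ * Q0 f f
      = s⁻¹ * ∑ i, Q0 (d i) (d i) + ρ⁻¹ * ∑ b ∈ bonds, (d b.1 b.2 - d b.2 b.1) ^ 2 := by
    simp only [Q0_self, hg', Fin.sum_univ_three, hdi]
    clear_value d
    simp [bonds, harmonicStep]
    field_simp
    ring
  have h1 : 0 ≤ s⁻¹ * ∑ i, Q0 (d i) (d i) :=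
    mul_nonneg (by positivity) (Finset.sum_nonneg fun i _ => Q0_self_nonneg _)
  have h2 : 0 ≤ ρ⁻¹ * ∑ b ∈ bonds, (d b.1 b.2 - d b.2 b.1) ^ 2 := by positivity
  linarith

/-! ### Energies on words of a given length -/

variable (S : Config)

/-- The last letter is the innermost map of `Gw`, so splitting it off refines each cell of level `m`
separately. -/
lemma sum_words_succ (F : List (Fin 3) → ℝ) (m : ℕ) :
    ∑ w : Fin (m + 1) → Fin 3, F (List.ofFn w)
      = ∑ w : Fin m → Fin 3, ∑ i, F (List.ofFn w ++ [i]) := by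
  rw [← Fintype.sum_prod_type' (f := fun (w : Fin m → Fin 3) i => F (List.ofFn w ++ [i]))]
  refine (Fintype.sum_equiv ((Equiv.prodComm _ _).trans (Fin.snocEquiv fun _ => Fin 3)) _ _
    fun x => ?_).symm
  change _ = F (List.ofFn (Fin.snoc (α := fun _ => Fin 3) x.1 x.2))
  rw [List.ofFn_succ', List.concat_eq_append]
  simp only [Fin.snoc_castSucc, Fin.snoc_last]

lemma Gw_append (w : List (Fin 3)) (i : Fin 3) (x : Plane) :
    Gw S (w ++ [i]) x = Gw S w (G S i x) := by
  induction w with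
  | nil => rfl
  | cons j w ih => simp only [List.cons_append, Gw, Function.comp, ih]

lemma G_p (i : Fin 3) : G S i (S.p i) = S.p i := by simp [G]

lemma vertex_append_self (w : List (Fin 3)) (i : Fin 3) :
    vertex S (w ++ [i]) i = vertex S w i :=
  Subtype.ext (by simp only [vertex, Gw_append, G_p])

lemma edge_zero (w : List (Fin 3)) (b : bonds) :
    edge S w b 0 = vertex S (w ++ [b.1.1]) b.1.2 :=
  Subtype.ext (by simp [edge, vertex, Gw_append, corner])

lemma edge_one (w : List (Fin 3)) (b : bonds) :
    edge S w b 1 = vertex S (w ++ [b.1.2]) b.1.1 :=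
  Subtype.ext (by simp [edge, vertex, Gw_append, corner])

lemma continuous_edge (w : List (Fin 3)) (b : bonds) : Continuous (edge S w b) := by
  unfold edge
  refine Continuous.subtype_mk ?_ _
  simp only [AffineMap.lineMap_apply_module]
  fun_prop

lemma QSigma_self_nonneg (m : ℕ) (u : K S → ℝ) : 0 ≤ QSigma S m u u :=
  Finset.sum_nonneg fun _ _ => Q0_self_nonneg _

lemma DI_self_nonneg (m : ℕ) (u : K S → ℝ) : 0 ≤ DI S m u u :=
  Finset.sum_nonneg fun _ _ => Finset.sum_nonneg fun _ _ => dirichlet_self_nonneg _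

lemma abs_QSigma_le (m : ℕ) (u v : K S → ℝ) :
    |QSigma S m u v| ≤ (QSigma S m u u + QSigma S m v v) / 2 := by
  simp only [QSigma, ← Finset.sum_add_distrib, Finset.sum_div]
  exact (Finset.abs_sum_le_sum_abs _ _).trans (Finset.sum_le_sum fun _ _ => abs_Q0_le _ _)

variable {S}

lemma abs_DI_le (m : ℕ) {u v : K S → ℝ} (hu : u ∈ FTilde S) (hv : v ∈ FTilde S) :
    |DI S m u v| ≤ (DI S m u u + DI S m v v) / 2 := by
  simp only [DI, ← Finset.sum_add_distrib, Finset.sum_div]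
  refine (Finset.abs_sum_le_sum_abs _ _).trans (Finset.sum_le_sum fun w _ => ?_)
  exact (Finset.abs_sum_le_sum_abs _ _).trans
    (Finset.sum_le_sum fun b _ => abs_dirichlet_le (hu.2 _ b) (hv.2 _ b))

/-- The network inequality is applied in every cell of level `m`, with each bond term bounded by the
Dirichlet integral over its segment. -/
lemma QSigma_step {u : K S → ℝ} (hu : u ∈ FTilde S) {s ρ : ℝ} (hs : 0 < s) (hρ : 0 < ρ) (m : ℕ) :
    (5 / 3 * s + ρ)⁻¹ * QSigma S m u u ≤ s⁻¹ * QSigma S (m + 1) u u + ρ⁻¹ * DI S m u u := by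
  have e := sum_words_succ
    (fun w => Q0 (fun i => u (vertex S w i)) (fun i => u (vertex S w i))) m
  rw [QSigma, QSigma, e, DI, Finset.mul_sum, Finset.mul_sum, Finset.mul_sum,
    ← Finset.sum_add_distrib]
  refine Finset.sum_le_sum fun w _ => ?_
  refine (Q0_le_network hs hρ _ (fun i j => u (vertex S (List.ofFn w ++ [i]) j))
    fun i => by rw [vertex_append_self]).trans ?_
  gcongr
  rw [← Finset.sum_coe_sort bonds]
  refine Finset.sum_le_sum fun b _ => ?_
  have := sq_sub_le_dirichlet (hu.1.comp (continuous_edge S (List.ofFn w) b)) (hu.2 _ b)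
  simpa only [Function.comp, edge_zero, edge_one] using this

/-! ### Sequences of matching pairs -/

lemma delta_pos (R : MPSeq) (m : ℕ) : 0 < delta R m :=
  Finset.prod_pos fun k _ => (R k).r_pos

lemma delta_succ (R : MPSeq) (m : ℕ) : delta R (m + 1) = delta R m * (R m).r :=
  Finset.prod_range_succ _ _

lemma gamma_pos (R : MPSeq) (m : ℕ) : 0 < gamma R m := mul_pos (delta_pos R m) (R m).ρ_pos

/-- The proportion `∏_{k < m} 5 / 3 * r_k` of the energy of a harmonic function that is carried by
the cells of level `m`. -/
def cellShare (R : MPSeq) (m : ℕ) : ℝ := ∏ k ∈ Finset.range m, (5 / 3 * (R k).r)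

/-- The limit of `cellShare R m` as `m → ∞`. -/
def sgShare (R : MPSeq) : ℝ := ⨅ m, cellShare R m

variable (R : MPSeq)

lemma cellShare_pos (m : ℕ) : 0 < cellShare R m :=
  Finset.prod_pos fun k _ => by linarith [(R k).r_pos]

lemma cellShare_succ (m : ℕ) : cellShare R (m + 1) = cellShare R m * (5 / 3 * (R m).r) :=
  Finset.prod_range_succ _ _

lemma cellShare_zero : cellShare R 0 = 1 := Finset.prod_range_zero _

lemma cellShare_succ_lt (m : ℕ) : cellShare R (m + 1) < cellShare R m := by
  rw [cellShare_succ]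
  exact mul_lt_of_lt_one_right (cellShare_pos R m) (by linarith [(R m).matching, (R m).ρ_pos])

lemma antitone_cellShare : Antitone (cellShare R) :=
  antitone_nat_of_succ_le fun m => (cellShare_succ_lt R m).le

lemma bddBelow_cellShare : BddBelow (range (cellShare R)) :=
  ⟨0, by rintro _ ⟨m, rfl⟩; exact (cellShare_pos R m).le⟩

lemma tendsto_cellShare : Tendsto (cellShare R) atTop (𝓝 (sgShare R)) :=
  tendsto_atTop_ciInf (antitone_cellShare R) (bddBelow_cellShare R)

lemma sgShare_nonneg : 0 ≤ sgShare R := le_ciInf fun m => (cellShare_pos R m).le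

lemma sgShare_lt (m : ℕ) : sgShare R < cellShare R m :=
  (ciInf_le (bddBelow_cellShare R) (m + 1)).trans_lt (cellShare_succ_lt R m)

lemma cellShare_eq (m : ℕ) : cellShare R m = ∏ k ∈ Finset.range m, (1 - (R k).ρ) :=
  Finset.prod_congr rfl fun k _ => by linarith [(R k).matching]

lemma one_sub_sum_le_prod_one_sub {x : ℕ → ℝ} (h0 : ∀ k, 0 ≤ x k) (h1 : ∀ k, x k ≤ 1) (n : ℕ) :
    1 - ∑ k ∈ Finset.range n, x k ≤ ∏ k ∈ Finset.range n, (1 - x k) := by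
  induction n with
  | zero => simp
  | succ n ih =>
    rw [Finset.sum_range_succ, Finset.prod_range_succ]
    have hp : ∏ k ∈ Finset.range n, (1 - x k) ≤ 1 :=
      Finset.prod_le_one (fun k _ => by linarith [h1 k]) fun k _ => by linarith [h0 k]
    nlinarith [mul_le_mul_of_nonneg_right hp (h0 n)]

/-- The classical criterion for the product `∏ (1 - ρ_k)`: a summable tail keeps it away from `0` by
the Weierstrass inequality, and `1 - x ≤ exp (-x)` sends it to `0` when the sum diverges. -/
lemma sgShare_eq_zero_iff : sgShare R = 0 ↔ SumRhoInfinite R := by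
  have hρ : ∀ k, 0 ≤ (R k).ρ := fun k => (R k).ρ_pos.le
  have hρ1 : ∀ k, (R k).ρ ≤ 1 := fun k => by linarith [(R k).matching, (R k).r_pos]
  constructor
  · intro h
    rw [SumRhoInfinite, ← not_summable_iff_tendsto_nat_atTop_of_nonneg hρ]
    intro hs
    -- Past an index where the tail sum is below `1 / 2`, the product loses at most half of its
    -- value.
    obtain ⟨N, hN⟩ := ((tendsto_sum_nat_add fun k => (R k).ρ).eventually
      (gt_mem_nhds (show (0 : ℝ) < 1 / 2 by norm_num))).exists
    have key : ∀ n, cellShare R N / 2 ≤ cellShare R (N + n) := by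
      intro n
      have a := one_sub_sum_le_prod_one_sub (x := fun k => (R (k + N)).ρ) (fun k => hρ _)
        (fun k => hρ1 _) n
      have b : ∑ k ∈ Finset.range n, (R (k + N)).ρ ≤ ∑' k, (R (k + N)).ρ :=
        ((summable_nat_add_iff N).2 hs).sum_le_tsum _ fun k _ => hρ _
      have c : cellShare R (N + n)
          = cellShare R N * ∏ k ∈ Finset.range n, (1 - (R (k + N)).ρ) := by
        rw [cellShare_eq, cellShare_eq, Finset.prod_range_add]
        simp only [add_comm N]
      rw [c, div_eq_mul_inv]
      exact mul_le_mul_of_nonneg_left (by norm_num; linarith) (cellShare_pos R N).le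
    have hlim := (tendsto_cellShare R).comp (tendsto_add_atTop_nat N)
    have := ge_of_tendsto hlim (Eventually.of_forall fun n => by
      have := key n
      rw [add_comm] at this
      exact this)
    linarith [cellShare_pos R N]
  · intro h
    refine tendsto_nhds_unique (tendsto_cellShare R) ?_
    refine squeeze_zero (fun m => (cellShare_pos R m).le) (fun m => ?_)
      (Real.tendsto_exp_neg_atTop_nhds_zero.comp h)
    rw [cellShare_eq, Function.comp, ← Finset.sum_neg_distrib, Real.exp_sum]
    exact Finset.prod_le_prod (fun k _ => by linarith [hρ1 k])
      fun k _ => by linarith [Real.add_one_le_exp (-(R k).ρ)]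

/-- The resistance between the boundary points when the cells carry no energy in the limit, for
the sequence `R` shifted by `m`. -/
def lineResistance (m : ℕ) : ℝ := 1 - sgShare R / cellShare R m

lemma lineResistance_pos (m : ℕ) : 0 < lineResistance R m :=
  sub_pos.2 ((div_lt_one (cellShare_pos R m)).2 (sgShare_lt R m))

lemma lineResistance_le_one (m : ℕ) : lineResistance R m ≤ 1 :=
  sub_le_self _ (div_nonneg (sgShare_nonneg R) (cellShare_pos R m).le)

/-- The recursion is affine: the constant `1` solves it by the matching condition, and `1 /
cellShare` solves its homogeneous part. -/
lemma resistance_step (C : ℝ) (k : ℕ) :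
    5 / 3 * ((R k).r * (1 + C / cellShare R (k + 1))) + (R k).ρ = 1 + C / cellShare R k := by
  have h1 := (cellShare_pos R k).ne'
  have h2 := (R k).r_pos.ne'
  have h3 : (R k).ρ = 1 - 5 / 3 * (R k).r := by linarith [(R k).matching]
  rw [cellShare_succ, h3]
  field_simp
  ring

lemma lineResistance_step (k : ℕ) :
    5 / 3 * ((R k).r * lineResistance R (k + 1)) + (R k).ρ = lineResistance R k := by
  have := resistance_step R (-sgShare R) k
  simpa only [lineResistance, neg_div, ← sub_eq_add_neg] using this

/-- The sequence of matching pairs of the line part. -/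
def lineSeq : MPSeq := fun k =>
  { r := (R k).r * lineResistance R (k + 1) / lineResistance R k
    ρ := (R k).ρ / lineResistance R k
    r_pos := div_pos (mul_pos (R k).r_pos (lineResistance_pos R _)) (lineResistance_pos R _)
    ρ_pos := div_pos (R k).ρ_pos (lineResistance_pos R _)
    matching := by
      rw [← mul_div_assoc, ← add_div, lineResistance_step, div_self (lineResistance_pos R k).ne'] }

lemma delta_lineSeq (m : ℕ) :
    delta (lineSeq R) m = delta R m * lineResistance R m / lineResistance R 0 := by
  induction m with
  | zero => simp [delta, (lineResistance_pos R 0).ne']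
  | succ m ih =>
    rw [delta_succ, ih, delta_succ]
    have := (lineResistance_pos R m).ne'
    simp only [lineSeq]
    field_simp

/-- The level-dependent factor `lineResistance R m` in `delta` cancels against the one in `ρ`. Only
a constant remains, so the line forms of `R` and `lineSeq R` are proportional. -/
lemma gamma_lineSeq (m : ℕ) : gamma (lineSeq R) m = gamma R m / lineResistance R 0 := by
  rw [gamma, delta_lineSeq, gamma]
  have := (lineResistance_pos R m).ne'
  simp only [lineSeq]
  field_simp

lemma cellShare_eq_delta (m : ℕ) : cellShare R m = (5 / 3) ^ m * delta R m := by
  rw [cellShare, Finset.prod_mul_distrib, Finset.prod_const, Finset.card_range, delta]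

/-- Renormalisation subtracts the limit from the cell shares, up to a constant factor, so the new
shares tend to `0`. -/
lemma sgShare_lineSeq : sgShare (lineSeq R) = 0 := by
  refine tendsto_nhds_unique (tendsto_cellShare _) ?_
  have h : ∀ m, cellShare (lineSeq R) m = (cellShare R m - sgShare R) / lineResistance R 0 := by
    intro m
    rw [cellShare_eq_delta, delta_lineSeq, lineResistance]
    have e := cellShare_eq_delta R m
    have := (cellShare_pos R m).ne'
    rw [← mul_div_assoc, ← mul_assoc, ← e]
    field_simp
  have := ((tendsto_cellShare R).sub_const (sgShare R)).div_const (lineResistance R 0)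
  rw [sub_self, zero_div] at this
  exact this.congr fun m => (h m).symm

lemma lineSeq_eq_self_iff : lineSeq R = R ↔ sgShare R = 0 := by
  constructor
  · intro h
    rw [← h, sgShare_lineSeq]
  · intro h
    funext k
    have : ∀ m, lineResistance R m = 1 := fun m => by simp [lineResistance, h]
    ext <;> simp [lineSeq, this]

/-- Level by level, `γ` and the known `δ` give `ρ`, the matching condition gives `r`, and this gives
the next `δ`. -/
lemma MPSeq.eq_of_gamma_eq {R R' : MPSeq} (h : ∀ k, gamma R k = gamma R' k) : R = R' := by
  have key : ∀ k, delta R k = delta R' k → R k = R' k := by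
    intro k hk
    have hρ : (R k).ρ = (R' k).ρ := by
      have := h k
      rw [gamma, gamma, hk] at this
      exact mul_left_cancel₀ (delta_pos R' k).ne' this
    exact MatchingPair.ext (by linarith [(R k).matching, (R' k).matching]) hρ
  have hd : ∀ k, delta R k = delta R' k := by
    intro k
    induction k with
    | zero => rfl
    | succ k ih => rw [delta_succ, delta_succ, ih, key k ih]
  exact funext fun k => key k (hd k)

end SSG
end

noncomputable section
namespace SSG
variable (S : Config)

/-! ### Barycentric coordinates -/

/-- The barycentric coordinates with respect to the triangle `p_1 p_2 p_3`. -/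
def bary (i : Fin 3) (x : Plane) : ℝ := 1 / 3 + 2 * inner ℝ (S.p i) x

lemma continuous_bary (i : Fin 3) : Continuous (bary S i) := by
  unfold bary; fun_prop

/-- Side length `1` and centroid `0` force inner products `1 / 3` on the diagonal and `-1 / 6` off
it, which explains the constants in `bary`. -/
lemma bary_p (i j : Fin 3) : bary S i (S.p j) = if i = j then 1 else 0 := by
  have hd : ∀ i j, i ≠ j →
      inner ℝ (S.p i) (S.p i) - 2 * inner ℝ (S.p i) (S.p j) + inner ℝ (S.p j) (S.p j) = (1 : ℝ) := by
    intro i j h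
    have := S.dist_p i j h
    rw [dist_eq_norm] at this
    have e := real_inner_sub_sub_self (S.p i) (S.p j)
    rw [real_inner_self_eq_norm_sq, this] at e
    linarith
  have hs : ∀ i, inner ℝ (S.p i) (S.p 0) + inner ℝ (S.p i) (S.p 1) + inner ℝ (S.p i) (S.p 2)
      = (0 : ℝ) := by
    intro i
    rw [← inner_add_right, ← inner_add_right, S.sum_p, inner_zero_right]
  have h01 := hd 0 1 (by decide)
  have h12 := hd 1 2 (by decide)
  have h02 := hd 0 2 (by decide)
  have h0 := hs 0
  have h1 := hs 1
  have h2 := hs 2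
  rw [real_inner_comm (S.p 0) (S.p 1)] at h1
  rw [real_inner_comm (S.p 0) (S.p 2), real_inner_comm (S.p 1) (S.p 2)] at h2
  fin_cases i <;> fin_cases j <;> simp only [bary, Fin.zero_eta, Fin.mk_one, Fin.reduceFinMk] <;>
    try simp only [real_inner_comm (S.p 0) (S.p 1), real_inner_comm (S.p 0) (S.p 2),
      real_inner_comm (S.p 1) (S.p 2)]
  all_goals
    first
    | rw [if_pos trivial]
    | rw [if_neg (by decide)]
    linarith

lemma sum_bary (x : Plane) : bary S 0 x + bary S 1 x + bary S 2 x = 1 := by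
  have : inner ℝ (S.p 0) x + inner ℝ (S.p 1) x + inner ℝ (S.p 2) x = (0 : ℝ) := by
    rw [← inner_add_left, ← inner_add_left, S.sum_p, inner_zero_left]
  simp only [bary]
  linarith

lemma bary_lineMap (i : Fin 3) (x y : Plane) (t : ℝ) :
    bary S i (AffineMap.lineMap x y t) = (1 - t) * bary S i x + t * bary S i y := by
  simp only [bary, AffineMap.lineMap_apply_module, inner_add_right, inner_smul_right]
  ring

lemma bary_G (i j : Fin 3) (x : Plane) :
    bary S j (G S i x) = (1 - S.α) / 2 * bary S j x + if j = i then 1 - (1 - S.α) / 2 else 0 := by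
  have e : G S i x = AffineMap.lineMap (S.p i) x ((1 - S.α) / 2) := by
    simp only [G, AffineMap.lineMap_apply_module]
    module
  rw [e, bary_lineMap, bary_p]
  split_ifs <;> ring

lemma bary_nonneg (i : Fin 3) {x : Plane} (hx : x ∈ K S) : 0 ≤ bary S i x := by
  have hG : ∀ (j : Fin 3) (x : Plane), 0 ≤ bary S i x → 0 ≤ bary S i (G S j x) := by
    intro j x hx
    rw [bary_G]
    have := mul_nonneg (c_pos S).le hx
    have := c_lt S
    split_ifs <;> linarith
  have hcl : IsClosed {x | 0 ≤ bary S i x} := isClosed_le continuous_const (continuous_bary S i)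
  refine closure_minimal (iUnion_subset fun w => iUnion₂_subset fun b hb => ?_) hcl hx
  rintro _ ⟨y, hy, rfl⟩
  induction w with
  | nil =>
    rw [seg, segment_eq_image_lineMap] at hy
    obtain ⟨t, ht, rfl⟩ := hy
    have hp : ∀ j, 0 ≤ bary S i (S.p j) := fun j => by
      rw [bary_p]; split_ifs <;> norm_num
    have h1 : 0 ≤ bary S i (corner S b) := hG _ _ (hp _)
    have h2 : 0 ≤ bary S i (corner S b.swap) := hG _ _ (hp _)
    change 0 ≤ bary S i (AffineMap.lineMap _ _ t)
    rw [bary_lineMap]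
    exact add_nonneg (mul_nonneg (by linarith [ht.2]) h1) (mul_nonneg ht.1 h2)
  | cons j w ih => exact hG j _ ih

lemma bary_le_one (i : Fin 3) {x : Plane} (hx : x ∈ K S) : bary S i x ≤ 1 := by
  have h0 := bary_nonneg S 0 hx
  have h1 := bary_nonneg S 1 hx
  have h2 := bary_nonneg S 2 hx
  have := sum_bary S x
  fin_cases i <;> simp only [Fin.zero_eta, Fin.mk_one, Fin.reduceFinMk] <;> linarith

/-! ### Gluing functions on the cells and bonds -/

/-- The inverse of `G_i`. -/
def Ginv (i : Fin 3) (x : Plane) : Plane := ((1 - S.α) / 2)⁻¹ • (x - S.p i) + S.p i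

lemma Ginv_G (i : Fin 3) (x : Plane) : Ginv S i (G S i x) = x := by
  rw [Ginv, G, add_sub_cancel_right, inv_smul_smul₀ (c_pos S).ne', sub_add_cancel]

lemma continuous_Ginv (i : Fin 3) : Continuous (Ginv S i) := by
  unfold Ginv; fun_prop

/-- The affine function on `e_{ij}` with the values `g i j` at `p_{ij}` and `g j i` at `p_{ji}`. -/
def bondValue (g : Fin 3 → Fin 3 → ℝ) (b : Fin 3 × Fin 3) (x : Plane) : ℝ :=
  ((bary S b.1 x - (1 - S.α) / 2) * g b.1 b.2 + (bary S b.2 x - (1 - S.α) / 2) * g b.2 b.1) / S.α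

lemma continuous_bondValue (g : Fin 3 → Fin 3 → ℝ) (b : Fin 3 × Fin 3) :
    Continuous (bondValue S g b) := by
  have h1 := continuous_bary S b.1
  have h2 := continuous_bary S b.2
  unfold bondValue
  fun_prop

/-- The parametrisation of `e_{ij}`. -/
def bondPoint (b : Fin 3 × Fin 3) (t : ℝ) : Plane :=
  AffineMap.lineMap (corner S b) (corner S b.swap) t

lemma bary_bondPoint (i : Fin 3) (b : Fin 3 × Fin 3) (hb : b.1 ≠ b.2) (t : ℝ) :
    bary S i (bondPoint S b t) =
      if i = b.1 then (1 + S.α) / 2 - t * S.α else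
        if i = b.2 then (1 - S.α) / 2 + t * S.α else 0 := by
  rw [bondPoint, bary_lineMap, corner, corner, bary_G, bary_G, bary_p, bary_p]
  simp only [Prod.fst_swap, Prod.snd_swap]
  split_ifs with h1 h2 h3
  · exact absurd (h1.symm.trans h2) (Ne.symm hb)
  all_goals ring

lemma ne_of_mem_bonds {b : Fin 3 × Fin 3} (hb : b ∈ bonds) : b.1 ≠ b.2 := by
  revert b; decide

lemma bondPoint_mem {b : Fin 3 × Fin 3} (hb : b ∈ bonds) {t : ℝ} (ht : t ∈ Icc (0 : ℝ) 1) :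
    bondPoint S b t ∈ K S :=
  lineMap_mem S [] ⟨b, hb⟩ ⟨t, ht⟩

lemma bondValue_bondPoint (g : Fin 3 → Fin 3 → ℝ) {b : Fin 3 × Fin 3} (hb : b ∈ bonds) (t : ℝ) :
    bondValue S g b (bondPoint S b t) = (1 - t) * g b.1 b.2 + t * g b.2 b.1 := by
  have h := ne_of_mem_bonds hb
  rw [bondValue, bary_bondPoint S _ _ h, bary_bondPoint S _ _ h, if_pos rfl, if_neg h.symm,
    if_pos rfl]
  have := S.α_pos.ne'
  field_simp
  ring

lemma eq_or_eq_bondPoint {x : Plane} (hx : x ∈ K S) :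
    (∃ i, ∃ y ∈ K S, G S i y = x) ∨ ∃ b ∈ bonds, ∃ t ∈ Icc (0 : ℝ) 1, bondPoint S b t = x := by
  rw [K_eq_step] at hx
  rcases hx with hx | hx
  · obtain ⟨i, y, hy, h⟩ := mem_iUnion.1 hx
    exact Or.inl ⟨i, y, hy, h⟩
  · obtain ⟨b, hb, hx⟩ := mem_iUnion₂.1 hx
    rw [seg, segment_eq_image_lineMap] at hx
    obtain ⟨t, ht, h⟩ := hx
    exact Or.inr ⟨b, hb, t, ht, h⟩

open Classical in
/-- The function equal to `H i ∘ G_i⁻¹` on the cells `G_i(K)` and to the affine function with the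
boundary values given by `g` on the bonds. -/
def glue (g : Fin 3 → Fin 3 → ℝ) (H : Fin 3 → Plane → ℝ) (x : Plane) : ℝ :=
  if (1 + S.α) / 2 ≤ bary S 0 x then H 0 (Ginv S 0 x)
  else if (1 + S.α) / 2 ≤ bary S 1 x then H 1 (Ginv S 1 x)
  else if (1 + S.α) / 2 ≤ bary S 2 x then H 2 (Ginv S 2 x)
  else if bary S 2 x = 0 then bondValue S g (0, 1) x
  else if bary S 0 x = 0 then bondValue S g (1, 2) x
  else bondValue S g (2, 0) x

variable {g : Fin 3 → Fin 3 → ℝ} {H : Fin 3 → Plane → ℝ}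

/-- On the cell `i` the coordinate `i` is at least `(1 + α) / 2` and the others are at most `(1 - α)
/ 2`, so the thresholds in `glue` separate the cells. -/
lemma glue_G (i : Fin 3) {x : Plane} (hx : x ∈ K S) : glue S g H (G S i x) = H i x := by
  have hlt := S.α_pos
  have hc := c_pos S
  have hle : ∀ j, j ≠ i → ¬ (1 + S.α) / 2 ≤ bary S j (G S i x) := by
    intro j hj
    rw [bary_G, if_neg hj]
    have := mul_le_of_le_one_right hc.le (bary_le_one S j hx)
    linarith
  have hge : (1 + S.α) / 2 ≤ bary S i (G S i x) := by
    rw [bary_G, if_pos rfl]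
    have := mul_nonneg hc.le (bary_nonneg S i hx)
    linarith
  fin_cases i <;> simp only [Fin.zero_eta, Fin.mk_one, Fin.reduceFinMk] at hle hge ⊢
  · rw [glue, if_pos hge, Ginv_G]
  · rw [glue, if_neg (hle 0 (by decide)), if_pos hge, Ginv_G]
  · rw [glue, if_neg (hle 0 (by decide)), if_neg (hle 1 (by decide)), if_pos hge, Ginv_G]

/-- The endpoints lie in cells, where `hH` gives compatibility. The open bond misses every threshold
and is recognised by its vanishing coordinate. -/
lemma glue_bondPoint (hH : ∀ i j, H i (S.p j) = g i j) {b : Fin 3 × Fin 3} (hb : b ∈ bonds) {t : ℝ}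
    (ht : t ∈ Icc (0 : ℝ) 1) :
    glue S g H (bondPoint S b t) = (1 - t) * g b.1 b.2 + t * g b.2 b.1 := by
  have hα := S.α_pos
  have hα1 := S.α_lt_one
  rcases eq_or_lt_of_le ht.1 with h0 | h0
  · rw [← h0, bondPoint, AffineMap.lineMap_apply_zero, corner, glue_G S _ (p_mem S _), hH]
    ring
  rcases eq_or_lt_of_le ht.2 with h1 | h1
  · rw [h1, bondPoint, AffineMap.lineMap_apply_one, corner, glue_G S _ (p_mem S _), hH]
    simp
  have k0 : 0 < t * S.α := mul_pos h0 hα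
  have k1 : t * S.α < S.α := mul_lt_of_lt_one_left hα h1
  have hne := ne_of_mem_bonds hb
  have hn : ∀ i, ¬ (1 + S.α) / 2 ≤ bary S i (bondPoint S b t) := by
    intro i
    rw [bary_bondPoint S i b hne]
    split_ifs <;> linarith
  rw [← bondValue_bondPoint S g hb t, glue, if_neg (hn 0), if_neg (hn 1), if_neg (hn 2),
    bary_bondPoint S 2 b hne, bary_bondPoint S 0 b hne]
  have n1 : (1 + S.α) / 2 - t * S.α ≠ 0 := by intro h; linarith
  have n2 : (1 - S.α) / 2 + t * S.α ≠ 0 := by intro h; linarith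
  simp only [bonds, Finset.mem_insert, Finset.mem_singleton] at hb
  rcases hb with rfl | rfl | rfl <;> simp [n1, n2]

lemma continuousOn_glue (hH : ∀ i j, H i (S.p j) = g i j) (hc : ∀ i, ContinuousOn (H i) (K S)) :
    ContinuousOn (glue S g H) (K S) := by
  have hK : IsCompact (K S) := ((isCompact_and_eq_iff S (K S)).2 rfl).1
  rw [K_eq_step, step]
  have hcl : ∀ i, IsClosed (G S i '' K S) := fun i => (hK.image (continuous_G S i)).isClosed
  have e : (⋃ b ∈ bonds, seg S b) = ⋃ b : bonds, seg S b := by simp [iUnion_subtype]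
  rw [e, continuousOn_union_iff_of_isClosed (isClosed_iUnion_of_finite hcl)
    (isClosed_iUnion_of_finite fun b => (isCompact_seg S _).isClosed)]
  constructor
  · refine (locallyFinite_of_finite _).continuousOn_iUnion hcl fun i => ?_
    refine ContinuousOn.congr (f := H i ∘ Ginv S i)
      ((hc i).comp (continuous_Ginv S i).continuousOn ?_) ?_
    · rintro _ ⟨x, hx, rfl⟩
      rwa [Ginv_G]
    · rintro _ ⟨x, hx, rfl⟩
      rw [glue_G S i hx, Function.comp, Ginv_G]
  · refine (locallyFinite_of_finite _).continuousOn_iUnion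
      (fun b => (isCompact_seg S _).isClosed) fun b => ?_
    refine (continuous_bondValue S g b).continuousOn.congr fun x hx => ?_
    rw [seg, segment_eq_image_lineMap] at hx
    obtain ⟨t, ht, rfl⟩ := hx
    exact (glue_bondPoint S hH b.2 ht).trans (bondValue_bondPoint S g b.2 t).symm

/-! ### Piecewise harmonic functions -/

/-- Approximations of the function that is harmonic with respect to the resistances `s k` of
the cells, and affine on the bonds: level `n` cells carry affine functions. -/
def approx : ℕ → (ℕ → ℝ) → (Fin 3 → ℝ) → Plane → ℝ
  | 0, _, f => fun x => f 0 * bary S 0 x + f 1 * bary S 1 x + f 2 * bary S 2 x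
  | n + 1, s, f => glue S (fun i => harmonicStep (s 0) i f)
      fun i => approx n (fun k => s (k + 1)) (harmonicStep (s 0) i f)

lemma approx_p (n : ℕ) (s : ℕ → ℝ) (f : Fin 3 → ℝ) (j : Fin 3) : approx S n s f (S.p j) = f j := by
  induction n generalizing s f with
  | zero => fin_cases j <;> simp [approx, bary_p]
  | succ n ih =>
    conv_lhs => rw [← G_p S j]
    rw [approx, glue_G S j (p_mem S j), ih, harmonicStep_self]

lemma continuousOn_approx (n : ℕ) (s : ℕ → ℝ) (f : Fin 3 → ℝ) :
    ContinuousOn (approx S n s f) (K S) := by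
  induction n generalizing s f with
  | zero =>
    have := continuous_bary S
    exact Continuous.continuousOn (by unfold approx; fun_prop)
  | succ n ih =>
    exact continuousOn_glue S (fun _ j => approx_p S n _ _ j) fun _ => ih _ _

lemma approx_succ_G (n : ℕ) (s : ℕ → ℝ) (f : Fin 3 → ℝ) (i : Fin 3) {x : Plane} (hx : x ∈ K S) :
    approx S (n + 1) s f (G S i x) = approx S n (fun k => s (k + 1)) (harmonicStep (s 0) i f) x :=
  glue_G S i hx

lemma approx_succ_bondPoint (n : ℕ) (s : ℕ → ℝ) (f : Fin 3 → ℝ) {b : Fin 3 × Fin 3}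
    (hb : b ∈ bonds) {t : ℝ} (ht : t ∈ Icc (0 : ℝ) 1) :
    approx S (n + 1) s f (bondPoint S b t)
      = (1 - t) * harmonicStep (s 0) b.1 f b.2 + t * harmonicStep (s 0) b.2 f b.1 :=
  glue_bondPoint S (fun _ j => approx_p S n _ _ j) hb ht

/-- This contraction of oscillations makes the approximations converge geometrically. For distinct
indices the bracket in `harmonicStep` is `2 * (f i - f j) + (f i - f k)`, hence at most `3 * D` in
absolute value, and its coefficient is at most `1 / 5`. -/
lemma abs_harmonicStep_sub_le {s : ℝ} (hs : s ∈ Icc (0 : ℝ) (3 / 5)) {f : Fin 3 → ℝ} {D : ℝ}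
    (hf : ∀ i j, |f i - f j| ≤ D) (i j k : Fin 3) :
    |harmonicStep s i f j - harmonicStep s i f k| ≤ 3 / 5 * D := by
  have h01 := abs_le.1 (hf 0 1)
  have h12 := abs_le.1 (hf 1 2)
  have h02 := abs_le.1 (hf 0 2)
  have hD : 0 ≤ D := (abs_nonneg _).trans (hf 0 1)
  suffices h : ∃ y, |y| ≤ 3 * D ∧ harmonicStep s i f j - harmonicStep s i f k = s / 3 * y by
    obtain ⟨y, hy, e⟩ := h
    rw [e, abs_mul, abs_of_nonneg (by linarith [hs.1])]
    calc s / 3 * |y| ≤ (3 / 5) / 3 * (3 * D) := by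
          gcongr
          exact hs.2
      _ = 3 / 5 * D := by ring
  by_cases hj : j = i <;> by_cases hk : k = i
  · exact ⟨0, by simpa using hD, by rw [hj, hk]; ring⟩
  · refine ⟨4 * f i - f k - (f 0 + f 1 + f 2), ?_, by simp [harmonicStep, hj, hk]⟩
    rw [abs_le]
    fin_cases i <;> fin_cases k <;> simp at hk ⊢ <;> constructor <;> linarith
  · refine ⟨-(4 * f i - f j - (f 0 + f 1 + f 2)), ?_, by simp [harmonicStep, hj, hk]; ring⟩
    rw [abs_neg, abs_le]
    fin_cases i <;> fin_cases j <;> simp at hj ⊢ <;> constructor <;> linarith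
  · refine ⟨f j - f k, (hf j k).trans (by linarith), ?_⟩
    rw [harmonicStep, harmonicStep, if_neg hj, if_neg hk]
    ring

lemma abs_approx_zero_sub_le {s : ℕ → ℝ} {f : Fin 3 → ℝ} {D : ℝ} (hf : ∀ i j, |f i - f j| ≤ D)
    {x : Plane} (hx : x ∈ K S) (j : Fin 3) : |approx S 0 s f x - f j| ≤ D := by
  have h := sum_bary S x
  have e : approx S 0 s f x - f j = (f 0 - f j) * bary S 0 x + (f 1 - f j) * bary S 1 x
      + (f 2 - f j) * bary S 2 x := by
    simp only [approx]
    linear_combination f j * h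
  have k : ∀ i, |(f i - f j) * bary S i x| ≤ D * bary S i x := fun i => by
    rw [abs_mul, abs_of_nonneg (bary_nonneg S i hx)]
    exact mul_le_mul_of_nonneg_right (hf i j) (bary_nonneg S i hx)
  rw [e]
  calc _ ≤ D * bary S 0 x + D * bary S 1 x + D * bary S 2 x :=
        (abs_add_three _ _ _).trans (add_le_add (add_le_add (k 0) (k 1)) (k 2))
    _ = D := by rw [← mul_add, ← mul_add, h, mul_one]

lemma abs_approx_succ_sub_le (n : ℕ) {s : ℕ → ℝ} (hs : ∀ k, s k ∈ Icc (0 : ℝ) (3 / 5))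
    {f : Fin 3 → ℝ} {D : ℝ} (hf : ∀ i j, |f i - f j| ≤ D) {x : Plane} (hx : x ∈ K S) :
    |approx S (n + 1) s f x - approx S n s f x| ≤ 3 * D * (3 / 5) ^ n := by
  have hD : 0 ≤ D := (abs_nonneg _).trans (hf 0 1)
  induction n generalizing s f D x with
  | zero =>
    -- The constant `3` is generous: comparison through a vertex value gives `8 / 5 * D` on cells
    -- and `13 / 5 * D` on bonds.
    rw [pow_zero, mul_one]
    have h0 := abs_approx_zero_sub_le S (s := s) hf hx
    have hA := abs_harmonicStep_sub_le (hs 0) hf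
    rcases eq_or_eq_bondPoint S hx with ⟨i, y, hy, rfl⟩ | ⟨b, hb, t, ht, rfl⟩
    · rw [approx_succ_G S 0 s f i hy]
      have h1 := abs_approx_zero_sub_le S (s := fun k => s (k + 1)) (hA i) hy i
      rw [harmonicStep_self] at h1
      have := abs_le.1 h1
      have := abs_le.1 (h0 i)
      rw [abs_le]
      constructor <;> linarith
    · rw [approx_succ_bondPoint S 0 s f hb ht]
      have h1 := abs_le.1 (hA b.1 b.2 b.1)
      have h2 := abs_le.1 (hA b.2 b.1 b.2)
      rw [harmonicStep_self] at h1 h2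
      have h3 := abs_le.1 (hf b.1 b.2)
      have h4 := abs_le.1 (h0 b.1)
      rw [abs_le]
      constructor <;> nlinarith [ht.1, ht.2]
  | succ n ih =>
    rcases eq_or_eq_bondPoint S hx with ⟨i, y, hy, rfl⟩ | ⟨b, hb, t, ht, rfl⟩
    · rw [approx_succ_G S _ s f i hy, approx_succ_G S _ s f i hy]
      refine (ih (fun k => hs (k + 1)) (abs_harmonicStep_sub_le (hs 0) hf i) hy
        (by positivity)).trans_eq ?_
      ring
    -- The first-level bonds are final after one gluing, so later approximations agree there.
    · rw [approx_succ_bondPoint S _ s f hb ht, approx_succ_bondPoint S _ s f hb ht, sub_self,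
        abs_zero]
      positivity

lemma exists_oscillation_bound (f : Fin 3 → ℝ) : ∃ D, ∀ i j, |f i - f j| ≤ D := by
  obtain ⟨D, hD⟩ := (Set.finite_range fun q : Fin 3 × Fin 3 => |f q.1 - f q.2|).bddAbove
  exact ⟨D, fun i j => hD ⟨(i, j), rfl⟩⟩

/-- The limit of the approximations. -/
def piecewiseHarmonic (s : ℕ → ℝ) (f : Fin 3 → ℝ) (x : Plane) : ℝ :=
  limUnder atTop fun n => approx S n s f x

lemma tendsto_approx {s : ℕ → ℝ} (hs : ∀ k, s k ∈ Icc (0 : ℝ) (3 / 5)) (f : Fin 3 → ℝ)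
    {x : Plane} (hx : x ∈ K S) :
    Tendsto (fun n => approx S n s f x) atTop (𝓝 (piecewiseHarmonic S s f x)) := by
  obtain ⟨D, hD⟩ := exists_oscillation_bound f
  refine (cauchySeq_of_le_geometric (3 / 5) (3 * D) (by norm_num) fun n => ?_).tendsto_limUnder
  rw [dist_comm]
  exact abs_approx_succ_sub_le S n hs hD hx

lemma continuousOn_piecewiseHarmonic {s : ℕ → ℝ} (hs : ∀ k, s k ∈ Icc (0 : ℝ) (3 / 5))
    (f : Fin 3 → ℝ) : ContinuousOn (piecewiseHarmonic S s f) (K S) := by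
  obtain ⟨D, hD⟩ := exists_oscillation_bound f
  have hlim : Tendsto (fun n : ℕ => 3 * D * (3 / 5 : ℝ) ^ n / (1 - 3 / 5)) atTop (𝓝 0) := by
    have := (((tendsto_pow_atTop_nhds_zero_of_lt_one (r := (3 / 5 : ℝ)) (by norm_num)
      (by norm_num)).const_mul (3 * D)).div_const (1 - 3 / 5))
    simpa using this
  refine TendstoUniformlyOn.continuousOn (F := fun n => approx S n s f) (p := atTop) ?_
    (Eventually.of_forall fun n => continuousOn_approx S n s f).frequently
  rw [Metric.tendstoUniformlyOn_iff]
  intro ε hε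
  filter_upwards [hlim.eventually (gt_mem_nhds hε)] with n hn x hx
  rw [dist_comm]
  refine (dist_le_of_le_geometric_of_tendsto (3 / 5) (3 * D) (by norm_num) (fun n => ?_)
    (tendsto_approx S hs f hx) n).trans_lt hn
  rw [dist_comm]
  exact abs_approx_succ_sub_le S n hs hD hx

lemma piecewiseHarmonic_G {s : ℕ → ℝ} (hs : ∀ k, s k ∈ Icc (0 : ℝ) (3 / 5)) (f : Fin 3 → ℝ)
    (i : Fin 3) {x : Plane} (hx : x ∈ K S) :
    piecewiseHarmonic S s f (G S i x)
      = piecewiseHarmonic S (fun k => s (k + 1)) (harmonicStep (s 0) i f) x := by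
  have h := (tendsto_approx S hs f (G_mem S i hx)).comp (tendsto_add_atTop_nat 1)
  refine tendsto_nhds_unique h ?_
  refine (tendsto_approx S (fun k => hs (k + 1)) (harmonicStep (s 0) i f) hx).congr fun n => ?_
  exact (approx_succ_G S n s f i hx).symm

lemma piecewiseHarmonic_bondPoint {s : ℕ → ℝ} (hs : ∀ k, s k ∈ Icc (0 : ℝ) (3 / 5))
    (f : Fin 3 → ℝ) {b : Fin 3 × Fin 3} (hb : b ∈ bonds) {t : ℝ} (ht : t ∈ Icc (0 : ℝ) 1) :
    piecewiseHarmonic S s f (bondPoint S b t)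
      = (1 - t) * harmonicStep (s 0) b.1 f b.2 + t * harmonicStep (s 0) b.2 f b.1 := by
  have h := (tendsto_approx S hs f (bondPoint_mem S hb ht)).comp (tendsto_add_atTop_nat 1)
  refine tendsto_nhds_unique h (tendsto_const_nhds.congr fun n => ?_)
  exact (approx_succ_bondPoint S n s f hb ht).symm

lemma piecewiseHarmonic_p (s : ℕ → ℝ) (f : Fin 3 → ℝ) (j : Fin 3) :
    piecewiseHarmonic S s f (S.p j) = f j := by
  simp only [piecewiseHarmonic, approx_p]
  exact tendsto_const_nhds.limUnder_eq

/-- The values of a piecewise harmonic function at `G_w(p_1)`, `G_w(p_2)`, `G_w(p_3)`. -/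
def cellValue : (ℕ → ℝ) → (Fin 3 → ℝ) → List (Fin 3) → Fin 3 → ℝ
  | _, f, [] => f
  | s, f, i :: w => cellValue (fun k => s (k + 1)) (harmonicStep (s 0) i f) w

lemma cellValue_append (s : ℕ → ℝ) (f : Fin 3 → ℝ) (w : List (Fin 3)) (i : Fin 3) :
    cellValue s f (w ++ [i]) = harmonicStep (s w.length) i (cellValue s f w) := by
  induction w generalizing s f with
  | nil => rfl
  | cons j w ih => simp only [List.cons_append, cellValue, ih, List.length_cons]

lemma piecewiseHarmonic_Gw {s : ℕ → ℝ} (hs : ∀ k, s k ∈ Icc (0 : ℝ) (3 / 5)) (f : Fin 3 → ℝ)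
    (w : List (Fin 3)) {x : Plane} (hx : x ∈ K S) :
    piecewiseHarmonic S s f (Gw S w x)
      = piecewiseHarmonic S (fun k => s (k + w.length)) (cellValue s f w) x := by
  induction w generalizing s f with
  | nil => rfl
  | cons j w ih =>
    rw [Gw, Function.comp, piecewiseHarmonic_G S hs f j (Gw_mem S w hx),
      ih fun k => hs (k + 1)]
    rfl

lemma sum_Q0_cellValue (s : ℕ → ℝ) (f : Fin 3 → ℝ) (m : ℕ) :
    ∑ w : Fin m → Fin 3, Q0 (cellValue s f (List.ofFn w)) (cellValue s f (List.ofFn w))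
      = (∏ k ∈ Finset.range m, (5 / 3 * s k ^ 2)) * Q0 f f := by
  induction m with
  | zero => simp [cellValue]
  | succ m ih =>
    rw [sum_words_succ fun w => Q0 (cellValue s f w) (cellValue s f w)]
    simp only [cellValue_append, List.length_ofFn, sum_Q0_harmonicStep]
    rw [← Finset.mul_sum, ih, Finset.prod_range_succ]
    ring

/-- For every sequence of cell resistances in `[0, 3 / 5]` and every choice of boundary values there
is a function in `𝓕~` that is harmonic on every level with these resistances. -/
lemma exists_piecewiseHarmonic {s : ℕ → ℝ} (hs : ∀ k, s k ∈ Icc (0 : ℝ) (3 / 5)) (f : Fin 3 → ℝ) :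
    ∃ u ∈ FTilde S, (∀ i, u (vertex S [] i) = f i) ∧
      (∀ m, QSigma S m u u = (∏ k ∈ Finset.range m, (5 / 3 * s k ^ 2)) * Q0 f f) ∧
      ∀ m, DI S m u u = (1 - 5 / 3 * s m) ^ 2 * QSigma S m u u := by
  let u : K S → ℝ := fun x => piecewiseHarmonic S s f x
  have hv : ∀ w i, u (vertex S w i) = cellValue s f w i := fun w i =>
    (piecewiseHarmonic_Gw S hs f w (p_mem S i)).trans (piecewiseHarmonic_p S _ _ i)
  have he : ∀ w (b : bonds) (t : unitInterval), (u ∘ edge S w b) t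
      = (1 - t) * harmonicStep (s w.length) b.1.1 (cellValue s f w) b.1.2
        + t * harmonicStep (s w.length) b.1.2 (cellValue s f w) b.1.1 := by
    intro w b t
    have e : ((edge S w b t : K S) : Plane) = Gw S w (bondPoint S b t) := (Gw_lineMap S w _ _ t).symm
    have hh := piecewiseHarmonic_bondPoint S (fun k => hs (k + w.length)) (cellValue s f w) b.2 t.2
    rw [zero_add] at hh
    rw [Function.comp, ← hh, ← piecewiseHarmonic_Gw S hs f w (bondPoint_mem S b.2 t.2), ← e]
  have hQ : ∀ m, QSigma S m u u = ∑ w : Fin m → Fin 3,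
      Q0 (cellValue s f (List.ofFn w)) (cellValue s f (List.ofFn w)) := by
    intro m
    simp only [QSigma, hv]
  refine ⟨u, ⟨continuousOn_iff_continuous_domRestrict.1 (continuousOn_piecewiseHarmonic S hs f),
    fun w b => memH1_of_affine (he w b)⟩, fun i => hv [] i,
    fun m => (hQ m).trans (sum_Q0_cellValue s f m), fun m => ?_⟩
  rw [hQ, DI, Finset.mul_sum]
  refine Finset.sum_congr rfl fun w _ => ?_
  rw [Q0, Finset.mul_sum, ← Finset.sum_coe_sort bonds]
  refine Finset.sum_congr rfl fun b _ => ?_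
  rw [dirichlet_self_of_affine (he _ b), harmonicStep_sub _ _ b.2, List.length_ofFn]
  ring

end SSG
end

noncomputable section
namespace SSG
variable {S : Config} {R : MPSeq}

/-! ### Line parts of energies -/

variable (S R) in
/-- The partial sum `∑_{k=1}^m γ_k⁻¹ 𝓓_k^I(u, v)`. -/
def linePartial (m : ℕ) (u v : K S → ℝ) : ℝ :=
  ∑ k ∈ Finset.range m, (gamma R k)⁻¹ * DI S k u v

lemma linePartial_succ (m : ℕ) (u v : K S → ℝ) :
    linePartial S R (m + 1) u v = linePartial S R m u v + (gamma R m)⁻¹ * DI S m u v :=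
  Finset.sum_range_succ _ _

lemma line_term_nonneg (k : ℕ) (u : K S → ℝ) : 0 ≤ (gamma R k)⁻¹ * DI S k u u :=
  mul_nonneg (inv_nonneg.2 (gamma_pos R k).le) (DI_self_nonneg S k u)

lemma linePartial_nonneg (m : ℕ) (u : K S → ℝ) : 0 ≤ linePartial S R m u u :=
  Finset.sum_nonneg fun k _ => line_term_nonneg k u

lemma cell_term_nonneg (m : ℕ) (u : K S → ℝ) : 0 ≤ (delta R m)⁻¹ * QSigma S m u u :=
  mul_nonneg (inv_nonneg.2 (delta_pos R m).le) (QSigma_self_nonneg S m u)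

/-- Cells of level `m + 1` are given resistance `b (m + 1) * delta R (m + 1)`; the recursion says
that together with the bonds they are equivalent to a level-`m` cell of resistance `b m * delta R
m`. -/
lemma monotone_cell_add_line {u : K S → ℝ} (hu : u ∈ FTilde S) {b : ℕ → ℝ} (hb : ∀ k, 0 < b k)
    (h : ∀ k, 5 / 3 * ((R k).r * b (k + 1)) + (R k).ρ = b k) :
    Monotone fun m => (b m * delta R m)⁻¹ * QSigma S m u u + linePartial S R m u u := by
  refine monotone_nat_of_le_succ fun m => ?_
  have k := QSigma_step hu (mul_pos (R m).r_pos (hb (m + 1))) (R m).ρ_pos m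
  rw [h] at k
  have k' := mul_le_mul_of_nonneg_left k (inv_nonneg.2 (delta_pos R m).le)
  rw [linePartial_succ, delta_succ, gamma]
  simp only [mul_inv] at k' ⊢
  linarith

lemma monotone_energyApprox {u : K S → ℝ} (hu : u ∈ FTilde S) :
    Monotone fun m => energyApprox S R m u u := by
  have := monotone_cell_add_line (R := R) hu (b := fun _ => 1) (fun _ => one_pos)
    fun k => by rw [mul_one, (R k).matching]
  simp only [one_mul] at this
  exact this

lemma tendsto_energyApprox_self {u : K S → ℝ} (hu : u ∈ (energy S R).dom) :
    Tendsto (fun m => energyApprox S R m u u) atTop (𝓝 ((energy S R).form u u)) :=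
  tendsto_nhds_limUnder hu.2

lemma energyApprox_le {u : K S → ℝ} (hu : u ∈ (energy S R).dom) (m : ℕ) :
    energyApprox S R m u u ≤ (energy S R).form u u :=
  (monotone_energyApprox hu.1).ge_of_tendsto (tendsto_energyApprox_self hu) m

lemma summable_line {u : K S → ℝ} (hu : u ∈ (energy S R).dom) :
    Summable fun k => (gamma R k)⁻¹ * DI S k u u :=
  summable_of_sum_range_le (fun k => line_term_nonneg k u) fun m =>
    (le_add_of_nonneg_left (cell_term_nonneg m u)).trans (energyApprox_le hu m)

lemma tendsto_cell {u : K S → ℝ} (hu : u ∈ (energy S R).dom) :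
    Tendsto (fun m => (delta R m)⁻¹ * QSigma S m u u) atTop (𝓝 (sgForm S R u u)) := by
  refine ((tendsto_energyApprox_self hu).sub (summable_line hu).hasSum.tendsto_sum_nat).congr
    fun m => ?_
  rw [energyApprox, add_sub_cancel_right]

variable (S R) in
/-- The functions of finite line energy in `𝓕~` whose cell energies tend to `0`. -/
structure HasLineEnergy (u : K S → ℝ) : Prop where
  mem : u ∈ FTilde S
  summable : Summable fun k => (gamma R k)⁻¹ * DI S k u u
  tendsto : Tendsto (fun m => (delta R m)⁻¹ * QSigma S m u u) atTop (𝓝 0)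

/-- Mixed terms are dominated by half the sum of the diagonal ones, so vanishing cell energies and
summable line energies pass to pairs. -/
lemma HasLineEnergy.tendsto_energyApprox {u v : K S → ℝ} (hu : HasLineEnergy S R u)
    (hv : HasLineEnergy S R v) :
    Tendsto (fun m => energyApprox S R m u v) atTop (𝓝 (lineForm S R u v)) := by
  have h1 : Tendsto (fun m => (delta R m)⁻¹ * QSigma S m u v) atTop (𝓝 0) := by
    refine squeeze_zero_norm (fun m => ?_)
      (by simpa using (hu.tendsto.add hv.tendsto).div_const 2)
    have hd := inv_pos.2 (delta_pos R m)
    rw [Real.norm_eq_abs, abs_mul, abs_of_pos hd, ← mul_add, mul_div_assoc]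
    exact mul_le_mul_of_nonneg_left (abs_QSigma_le S m u v) hd.le
  have h2 : Summable fun k => (gamma R k)⁻¹ * DI S k u v := by
    refine Summable.of_norm_bounded ((hu.summable.add hv.summable).div_const 2) fun k => ?_
    have hd := inv_pos.2 (gamma_pos R k)
    rw [Real.norm_eq_abs, abs_mul, abs_of_pos hd, ← mul_add, mul_div_assoc]
    exact mul_le_mul_of_nonneg_left (abs_DI_le k hu.mem hv.mem) hd.le
  have h := h1.add h2.hasSum.tendsto_sum_nat
  rw [zero_add] at h
  exact h

lemma HasLineEnergy.form_eq {u v : K S → ℝ} (hu : HasLineEnergy S R u)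
    (hv : HasLineEnergy S R v) : (energy S R).form u v = lineForm S R u v :=
  (hu.tendsto_energyApprox hv).limUnder_eq

lemma HasLineEnergy.mem_dom {u : K S → ℝ} (hu : HasLineEnergy S R u) : u ∈ (energy S R).dom :=
  ⟨hu.mem, _, hu.tendsto_energyApprox hu⟩

lemma mem_lineEnergy_iff {u : K S → ℝ} : u ∈ (lineEnergy S R).dom ↔ HasLineEnergy S R u := by
  constructor
  · rintro ⟨hu, h⟩
    exact ⟨hu.1, summable_line hu, h ▸ tendsto_cell hu⟩
  · intro hu
    exact ⟨hu.mem_dom, by rw [sgForm, hu.form_eq hu, sub_self]⟩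

/-! ### Cell energies are controlled by line energies -/

lemma one_add_div_cellShare_pos {C : ℝ} (hC : -sgShare R < C) (m : ℕ) :
    0 < 1 + C / cellShare R m := by
  have h := cellShare_pos R m
  rw [← div_self h.ne', ← add_div]
  exact div_pos (by linarith [sgShare_lt R m]) h

/-- For each admissible `C` the increasing quantity tends to the line energy, so it is bounded by it
at every level; the endpoint `C = -sgShare R` is reached by continuity at fixed `m`. -/
lemma cell_le_line_tail {u : K S → ℝ} (hu : u ∈ FTilde S)
    (hs : Summable fun k => (gamma R k)⁻¹ * DI S k u u)
    (h : ∀ C, -sgShare R < C → Tendsto (fun m =>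
      ((1 + C / cellShare R m) * delta R m)⁻¹ * QSigma S m u u) atTop (𝓝 0)) (m : ℕ) :
    (lineResistance R m * delta R m)⁻¹ * QSigma S m u u + linePartial S R m u u
      ≤ lineForm S R u u := by
  have h1 : ∀ C, -sgShare R < C → ((1 + C / cellShare R m) * delta R m)⁻¹ * QSigma S m u u
      + linePartial S R m u u ≤ lineForm S R u u := by
    intro C hC
    refine (monotone_cell_add_line hu (one_add_div_cellShare_pos hC)
      (resistance_step R C)).ge_of_tendsto ?_ m
    have h := (h C hC).add hs.hasSum.tendsto_sum_nat
    rw [zero_add] at h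
    exact h
  have e : lineResistance R m = 1 + -sgShare R / cellShare R m := by
    rw [lineResistance, neg_div, sub_eq_add_neg]
  have hne : (1 + -sgShare R / cellShare R m) * delta R m ≠ 0 := by
    rw [← e]
    exact (mul_pos (lineResistance_pos R m) (delta_pos R m)).ne'
  have hc : ContinuousAt (fun C => ((1 + C / cellShare R m) * delta R m)⁻¹ * QSigma S m u u
      + linePartial S R m u u) (-sgShare R) := by
    have hd : ContinuousAt (fun C => (1 + C / cellShare R m) * delta R m) (-sgShare R) := by
      fun_prop
    exact ((hd.inv₀ hne).mul_const _).add_const _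
  rw [e]
  -- The hypothesis is not available at `C = -sgShare R` itself, where `b_m` may tend to `0`; hence
  -- the limit from the right.
  exact le_of_tendsto (x := 𝓝[>] (-sgShare R)) (hc.tendsto.mono_left nhdsWithin_le_nhds)
    (eventually_mem_nhdsWithin.mono fun C hC => h1 C hC)

lemma tendsto_cell_div_lineResistance {u : K S → ℝ} (hu : u ∈ FTilde S)
    (hs : Summable fun k => (gamma R k)⁻¹ * DI S k u u)
    (h : ∀ C, -sgShare R < C → Tendsto (fun m =>
      ((1 + C / cellShare R m) * delta R m)⁻¹ * QSigma S m u u) atTop (𝓝 0)) :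
    Tendsto (fun m => (lineResistance R m * delta R m)⁻¹ * QSigma S m u u) atTop (𝓝 0) := by
  have hl := hs.hasSum.tendsto_sum_nat.const_sub (lineForm S R u u)
  rw [show lineForm S R u u - ∑' k, (gamma R k)⁻¹ * DI S k u u = 0 from sub_self _] at hl
  refine squeeze_zero (fun m => ?_) (fun m => le_sub_iff_add_le.2 (cell_le_line_tail hu hs h m)) hl
  exact mul_nonneg (inv_nonneg.2 (mul_pos (lineResistance_pos R m) (delta_pos R m)).le)
    (QSigma_self_nonneg S m u)

lemma tendsto_inv_one_add_div_cellShare {C : ℝ} (hC : -sgShare R < C) :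
    Tendsto (fun m => (1 + C / cellShare R m)⁻¹) atTop (𝓝 (sgShare R / (sgShare R + C))) := by
  have hne : sgShare R + C ≠ 0 := by intro h; linarith
  refine ((tendsto_cellShare R).div ((tendsto_cellShare R).add_const C) hne).congr fun m => ?_
  have h := (cellShare_pos R m).ne'
  rw [← div_self h, ← add_div, inv_div, Pi.div_apply]

/-- With `sgShare R = 0`, every `C > 0` gives `(1 + C / cellShare R m)⁻¹ → 0`, which suffices
because the cell energies are bounded by the total energy. -/
lemma hasLineEnergy_of_mem_dom (hR : sgShare R = 0) {u : K S → ℝ} (hu : u ∈ (energy S R).dom) :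
    HasLineEnergy S R u := by
  refine ⟨hu.1, summable_line hu, ?_⟩
  have h := tendsto_cell_div_lineResistance hu.1 (summable_line hu) fun C hC => ?_
  · simpa only [lineResistance, hR, zero_div, sub_zero, one_mul] using h
  · have hlim := (tendsto_inv_one_add_div_cellShare hC).mul_const ((energy S R).form u u)
    rw [hR, zero_div, zero_mul] at hlim
    have hpos := one_add_div_cellShare_pos hC
    refine squeeze_zero (fun m => ?_) (fun m => ?_) hlim
    · exact mul_nonneg (inv_nonneg.2 (mul_pos (hpos m) (delta_pos R m)).le)
        (QSigma_self_nonneg S m u)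
    · rw [mul_inv, mul_assoc]
      refine mul_le_mul_of_nonneg_left ?_ (inv_nonneg.2 (hpos m).le)
      exact (le_add_of_nonneg_right (linePartial_nonneg m u)).trans (energyApprox_le hu m)

lemma mem_dom_iff (hR : sgShare R = 0) {u : K S → ℝ} :
    u ∈ (energy S R).dom ↔ HasLineEnergy S R u :=
  ⟨hasLineEnergy_of_mem_dom hR, HasLineEnergy.mem_dom⟩

lemma line_term_lineSeq (k : ℕ) (u v : K S → ℝ) : (gamma (lineSeq R) k)⁻¹ * DI S k u v
    = lineResistance R 0 * ((gamma R k)⁻¹ * DI S k u v) := by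
  rw [gamma_lineSeq, inv_div, div_eq_mul_inv, mul_assoc]

lemma cell_term_lineSeq (m : ℕ) (u : K S → ℝ) : (delta (lineSeq R) m)⁻¹ * QSigma S m u u
    = lineResistance R 0 * ((lineResistance R m * delta R m)⁻¹ * QSigma S m u u) := by
  rw [delta_lineSeq, inv_div, div_eq_mul_inv, mul_assoc, mul_comm (delta R m)]

/-- Passing from `lineSeq R` to `R` only needs `lineResistance ≤ 1`. In the other direction the cell
energies are divided by a factor that may tend to `0`, and the tail estimate provides the required
decay. -/
lemma hasLineEnergy_lineSeq_iff {u : K S → ℝ} :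
    HasLineEnergy S (lineSeq R) u ↔ HasLineEnergy S R u := by
  have h0 := lineResistance_pos R 0
  constructor
  · intro h
    refine ⟨h.mem, ?_, ?_⟩
    · have := h.summable
      simp only [line_term_lineSeq] at this
      exact (summable_mul_left_iff h0.ne').1 this
    · have := h.tendsto.const_mul (lineResistance R 0)⁻¹
      simp only [cell_term_lineSeq, inv_mul_cancel_left₀ h0.ne', mul_zero] at this
      refine squeeze_zero (fun m => cell_term_nonneg m u) (fun m => ?_) this
      rw [mul_inv, mul_assoc]
      exact le_mul_of_one_le_left (cell_term_nonneg m u)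
        (one_le_inv_iff₀.2 ⟨lineResistance_pos R m, lineResistance_le_one R m⟩)
  · intro h
    refine ⟨h.mem, ?_, ?_⟩
    · simp only [line_term_lineSeq]
      exact h.summable.mul_left _
    · simp only [cell_term_lineSeq]
      have := (tendsto_cell_div_lineResistance h.mem h.summable fun C hC => ?_).const_mul
        (lineResistance R 0)
      · rwa [mul_zero] at this
      · have := (tendsto_inv_one_add_div_cellShare hC).mul h.tendsto
        rw [mul_zero] at this
        exact this.congr fun m => by rw [mul_inv, mul_assoc]

variable (S R) in
lemma same_lineSeq :
    ((lineEnergy S R).scale (lineResistance R 0)).Same (energy S (lineSeq R)) := by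
  constructor
  · ext u
    exact mem_lineEnergy_iff.trans
      (hasLineEnergy_lineSeq_iff.symm.trans (mem_dom_iff (sgShare_lineSeq R)).symm)
  · intro u hu v hv
    rw [(hasLineEnergy_lineSeq_iff.2 (mem_lineEnergy_iff.1 hu)).form_eq
      (hasLineEnergy_lineSeq_iff.2 (mem_lineEnergy_iff.1 hv)), lineForm]
    simp only [line_term_lineSeq, tsum_mul_left]
    rfl

/-! ### Harmonic functions, the trace on `V_0`, and uniqueness -/

variable (S R) in
-- With `s k = r_k` the matching condition turns the bond factor `1 - 5 / 3 * s k` into `ρ_k`, so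
-- each level moves the share `ρ_k` of the cell energy to the bonds and the total stays `Q0 f f`.
lemma exists_harmonic (f : Fin 3 → ℝ) : ∃ u ∈ FTilde S, (∀ i, u (vertex S [] i) = f i) ∧
    (∀ m, (delta R m)⁻¹ * QSigma S m u u = cellShare R m * Q0 f f) ∧
    ∀ m, energyApprox S R m u u = Q0 f f := by
  obtain ⟨u, hu, h0, hQ, hD⟩ := exists_piecewiseHarmonic S (s := fun k => (R k).r)
    (fun k => ⟨(R k).r_pos.le, by linarith [(R k).matching, (R k).ρ_pos]⟩) f
  have hc : ∀ m, (delta R m)⁻¹ * QSigma S m u u = cellShare R m * Q0 f f := by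
    intro m
    rw [hQ, ← mul_assoc, cellShare, delta, ← Finset.prod_inv_distrib, ← Finset.prod_mul_distrib]
    congr 1
    refine Finset.prod_congr rfl fun k _ => ?_
    have := (R k).r_pos.ne'
    field_simp
  refine ⟨u, hu, h0, hc, fun m => ?_⟩
  have key : ∀ m, linePartial S R m u u = (1 - cellShare R m) * Q0 f f := by
    intro m
    induction m with
    | zero => simp [linePartial, cellShare_zero]
    | succ m ih =>
      have e : (gamma R m)⁻¹ * DI S m u u = (R m).ρ * ((delta R m)⁻¹ * QSigma S m u u) := by
        have e1 : 1 - 5 / 3 * (R m).r = (R m).ρ := by linarith [(R m).matching]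
        have := (R m).ρ_pos.ne'
        rw [hD, gamma, e1]
        field_simp
      have e1 : 5 / 3 * (R m).r = 1 - (R m).ρ := by linarith [(R m).matching]
      rw [linePartial_succ, ih, e, hc, cellShare_succ, e1]
      ring
  change _ + linePartial S R m u u = _
  rw [hc, key]
  ring

lemma Q0_le_energyApprox {u : K S → ℝ} (hu : u ∈ FTilde S) {f : Fin 3 → ℝ}
    (hf : ∀ i, u (vertex S [] i) = f i) (m : ℕ) : Q0 f f ≤ energyApprox S R m u u := by
  have := monotone_energyApprox (R := R) hu (Nat.zero_le m)
  simpa [energyApprox, delta, QSigma, hf] using this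

variable (S R) in
-- The trace is computed for `lineSeq R`, where harmonic functions attain `Q0 f f` and monotonicity
-- gives the lower bound, and then rescaled.
lemma isR0_lineEnergy : IsR0 S (lineEnergy S R) (lineResistance R 0) := by
  have h0 := lineResistance_pos R 0
  obtain ⟨hdom, hform⟩ := same_lineSeq S R
  have hform' : ∀ v ∈ (lineEnergy S R).dom,
      (lineEnergy S R).form v v = (lineResistance R 0)⁻¹ * (energy S (lineSeq R)).form v v := by
    intro v hv
    rw [← hform v hv v hv]
    exact (inv_mul_cancel_left₀ h0.ne' _).symm
  refine ⟨h0, fun f => ⟨?_, ?_⟩⟩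
  · obtain ⟨u, hu, hf, -, he⟩ := exists_harmonic S (lineSeq R) f
    have ht : Tendsto (fun m => energyApprox S (lineSeq R) m u u) atTop (𝓝 (Q0 f f)) :=
      tendsto_const_nhds.congr fun m => (he m).symm
    have hd : u ∈ (lineEnergy S R).dom := (Set.ext_iff.1 hdom u).2 ⟨hu, _, ht⟩
    refine ⟨u, hd, hf, ?_⟩
    rw [hform' u hd, show (energy S (lineSeq R)).form u u = Q0 f f from ht.limUnder_eq]
  · rintro _ ⟨v, hv, hf, rfl⟩
    have hv' : v ∈ (energy S (lineSeq R)).dom := (Set.ext_iff.1 hdom v).1 hv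
    rw [hform' v hv]
    exact mul_le_mul_of_nonneg_left
      ((Q0_le_energyApprox hv'.1 hf 0).trans (energyApprox_le hv' 0)) (inv_nonneg.2 h0.le)

lemma exists_Q0_pos : ∃ f : Fin 3 → ℝ, 0 < Q0 f f := ⟨![1, 0, 0], by simp [Q0_self]⟩

lemma IsR0.eq {A : FormPair (K S)} {c c' : ℝ} (h : IsR0 S A c) (h' : IsR0 S A c') : c = c' := by
  obtain ⟨f, hf⟩ := exists_Q0_pos
  exact inv_injective (mul_right_cancel₀ hf.ne' ((h.2 f).unique (h'.2 f)))

/-- For each `k` there is a test function whose line energy at level `k` is positive and whose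
energy beyond it is zero; with the earlier `gamma` known by induction, its total energy determines
`gamma R k`. -/
lemma eq_of_energy_same {R R' : MPSeq} (h : (energy S R).Same (energy S R')) : R = R' := by
  refine MPSeq.eq_of_gamma_eq fun k => ?_
  induction k using Nat.strong_induction_on with
  | _ k ih =>
    obtain ⟨f, hf⟩ := exists_Q0_pos
    obtain ⟨u, hu, -, hQ, hD⟩ := exists_piecewiseHarmonic S
      -- A zero at level `k` makes the function constant on each cell of the next level, so all its
      -- variation there sits on the bonds; any nonzero admissible value would serve below `k`.
      (s := fun j => if j < k then 1 / 2 else 0)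
      (fun j => by split_ifs <;> constructor <;> norm_num) f
    have hQ0 : ∀ m, k < m → QSigma S m u u = 0 := by
      intro m hm
      rw [hQ, Finset.prod_eq_zero (Finset.mem_range.2 hm) (by simp), zero_mul]
    have hDk : 0 < DI S k u u := by
      rw [hD, hQ]
      refine mul_pos (by norm_num) (mul_pos (Finset.prod_pos fun j hj => ?_) hf)
      rw [if_pos (Finset.mem_range.1 hj)]
      norm_num
    have ht : ∀ R : MPSeq, Tendsto (fun m => energyApprox S R m u u) atTop
        (𝓝 (linePartial S R (k + 1) u u)) := by
      intro R
      refine tendsto_const_nhds.congr' ((eventually_ge_atTop (k + 1)).mono fun m hm => ?_)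
      have hz : (delta R m)⁻¹ * QSigma S m u u = 0 := by rw [hQ0 m hm, mul_zero]
      change _ = (delta R m)⁻¹ * QSigma S m u u + linePartial S R m u u
      rw [hz, zero_add]
      refine Finset.sum_subset (Finset.range_mono hm) fun j _ hj => ?_
      rw [hD, hQ0 j (by simpa using hj), mul_zero, mul_zero]
    have e := h.2 u ⟨hu, _, ht R⟩ u ⟨hu, _, ht R⟩
    have e1 : (energy S R).form u u = _ := (ht R).limUnder_eq
    have e2 : (energy S R').form u u = _ := (ht R').limUnder_eq
    have e3 : linePartial S R k u u = linePartial S R' k u u :=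
      Finset.sum_congr rfl fun j hj => by rw [ih j (Finset.mem_range.1 hj)]
    rw [e1, e2, linePartial_succ, linePartial_succ, e3] at e
    exact inv_injective (mul_right_cancel₀ hDk.ne' (add_left_cancel e))

variable (S R) in
lemma isLineProjection_lineSeq : IsLineProjection S R (lineSeq R) :=
  ⟨_, isR0_lineEnergy S R, same_lineSeq S R⟩

lemma IsLineProjection.eq {R' : MPSeq} (h : IsLineProjection S R R') : R' = lineSeq R := by
  obtain ⟨c, hc, hd, hf⟩ := h
  rw [hc.eq (isR0_lineEnergy S R)] at hd hf
  obtain ⟨hd', hf'⟩ := same_lineSeq S R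
  refine eq_of_energy_same (S := S) ⟨hd.symm.trans hd', fun u hu v hv => ?_⟩
  rw [← hd] at hu hv
  rw [← hf u hu v hv, hf' u hu v hv]

variable (S R) in
lemma lineProjection_eq : lineProjection S R = lineSeq R :=
  IsLineProjection.eq (Classical.epsilon_spec ⟨_, isLineProjection_lineSeq S R⟩)

variable (S) in
-- The SG energy of a harmonic function is `sgShare R * Q0 f f`, so one nonconstant boundary
-- function decides.
lemma sgShare_eq_zero_of_sgForm (h : ∀ u ∈ (energy S R).dom, sgForm S R u u = 0) :
    sgShare R = 0 := by
  obtain ⟨f, hf⟩ := exists_Q0_pos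
  obtain ⟨u, hu, -, hc, he⟩ := exists_harmonic S R f
  have hd : u ∈ (energy S R).dom := ⟨hu, Q0 f f, tendsto_const_nhds.congr fun m => (he m).symm⟩
  have h1 := tendsto_cell hd
  simp only [hc, h u hd] at h1
  have := tendsto_nhds_unique h1 ((tendsto_cellShare R).mul_const (Q0 f f))
  exact (mul_eq_zero.1 this.symm).resolve_right hf.ne'

end SSG
end

theorem mainTheorem7 (S : SSG.Config) (R : SSG.MPSeq) :
    (∃! R' : SSG.MPSeq, SSG.IsLineProjection S R R') ∧
    (SSG.lineProjection S R = R ↔ SSG.SumRhoInfinite R) ∧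
    ((∀ u ∈ (SSG.energy S R).dom, ∀ v ∈ (SSG.energy S R).dom,
        (SSG.energy S R).form u v = SSG.lineForm S R u v) ↔ SSG.SumRhoInfinite R) ∧
    ((SSG.energy S R).Same (SSG.lineEnergy S R) ↔ SSG.SumRhoInfinite R) ∧
    ((∀ u ∈ (SSG.energy S R).dom, ∀ v ∈ (SSG.energy S R).dom,
        SSG.sgForm S R u v = 0) ↔ SSG.SumRhoInfinite R) := by
  have hform : SSG.SumRhoInfinite R → ∀ u ∈ (SSG.energy S R).dom, ∀ v ∈ (SSG.energy S R).dom,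
      (SSG.energy S R).form u v = SSG.lineForm S R u v := fun h u hu v hv =>
    have h0 := (SSG.sgShare_eq_zero_iff R).2 h
    (SSG.hasLineEnergy_of_mem_dom h0 hu).form_eq (SSG.hasLineEnergy_of_mem_dom h0 hv)
  -- The diagonal alone suffices, so this one implication serves all three form conditions.
  have hconv : (∀ u ∈ (SSG.energy S R).dom, (SSG.energy S R).form u u = SSG.lineForm S R u u) →
      SSG.SumRhoInfinite R := fun h =>
    (SSG.sgShare_eq_zero_iff R).1
      (SSG.sgShare_eq_zero_of_sgForm S fun u hu => sub_eq_zero.2 (h u hu))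
  refine ⟨⟨_, SSG.isLineProjection_lineSeq S R, fun R' h => h.eq⟩, ?_,
    ⟨fun h => hconv fun u hu => h u hu u hu, hform⟩,
    ⟨fun h => hconv fun u hu => h.2 u hu u hu, fun h => ⟨?_, hform h⟩⟩,
    ⟨fun h => hconv fun u hu => sub_eq_zero.1 (h u hu u hu),
      fun h u hu v hv => sub_eq_zero.2 (hform h u hu v hv)⟩⟩
  · rw [SSG.lineProjection_eq, SSG.lineSeq_eq_self_iff, SSG.sgShare_eq_zero_iff]
  · ext u
    exact (SSG.mem_dom_iff ((SSG.sgShare_eq_zero_iff R).2 h)).trans SSG.mem_lineEnergy_iff.symm
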